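/- **Setting.** Let $p_0=(0,0)$, $p_1=(1,0)$, $p_2=(\tfrac12,\tfrac{\sqrt3}{2})$ in $\mathbb R^2$ and $f_i(x)=(x+p_i)/2$ for $i=0,1,2$. The Sierpiński gasket $K$ is the unique non-empty compact set with $K=f_0(K)\cup f_1(K)\cup f_2(K)$; it carries the Euclidean metric. Put $\alpha=\log3/\log2$, $\beta^*=\log5/\log2$, and let $\nu$ be the $\alpha$-dimensional Hausdorff measure on $K$ normalized to total mass $1$. For $n\ge0$ let $W_n=\{0,1,2\}^n$, and for $w=w_1\dots w_n\in W_n$ let $f_w=f_{w_1}\circ\dots\circ f_{w_n}$ and $V_w=f_w(\{p_0,p_1,p_2\})$. For a function $u$ on $K$ (measurable, in the case of $\mathcal E_\beta$) define, with values in $[0,\infty]$, $$E_\beta(u,u)=\sum_{n=1}^\infty2^{(\beta-\alpha)n}\sum_{w\in W_n}\sum_{p,q\in V_w}(u(p)-u(q))^2,\qquad \mathcal E_\beta(u,u)=\int_K\int_K\frac{(u(x)-u(y))^2}{|x-y|^{\alpha+\beta}}\,\nu(dx)\,\nu(dy),$$ $$\mathfrak E_{\mathrm{loc}}(u,u)=\lim_{n\to\infty}\Big(\frac53\Big)^n\sum_{w\in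 W_n}\sum_{p,q\in V_w}(u(p)-u(q))^2,$$ where $p,q$ run over ordered pairs; the sequence in the last formula is non-decreasing in $n$, so the limit exists. For $u\in L^2(K;\nu)$, the values $E_\beta(u,u)$ and $\mathfrak E_{\mathrm{loc}}(u,u)$ are those of the continuous version of $u$ if $u$ has one (it is then unique), and $+\infty$ otherwise. A closed form on a real Hilbert space $H$ is a symmetric non-negative bilinear form $\mathcal E$ on a dense subspace $D\subseteq H$ such that $D$ is complete for the inner product $\mathcal E(u,v)+(u,v)_H$; one puts $\mathcal E(u,u)=+\infty$ for $u\notin D$. Closed forms $\mathcal E^n$ converge to a closed form $\mathcal E$ in the sense of Mosco if (1) $\liminf_{n\to\infty}\mathcal E^n(u_n,u_n)\ge\mathcal E(u,u)$ whenever $u_n\to u$ weakly in $H$, and (2) every $u\in H$ is the strong limit of some sequence $(u_n)$ in $H$ with $\limsup_{n\to\infty}\mathcal E^n(u_n,u_n)\le\mathcal E(u,u)$. **Theorem.** (a) For every $\beta\in(\alpha,\infty)$ there is a constant $C>0$, depending only on $\beta$, such that for all $u\in C(K)$ $$E_\beta(u,u)\le C\,\mathcal E_\beta(u,u)\quad\text{and}\quad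 \mathcal E_\beta(u,u)\le C\,E_\beta(u,u).$$ (b) For every $u\in L^2(K;\nu)$, the function $\beta\mapsto(1-5^{-1}\cdot2^\beta)E_\beta(u,u)\in[0,\infty]$ is non-decreasing on $(\alpha,\beta^*)$ and converges to $\mathfrak E_{\mathrm{loc}}(u,u)$ as $\beta\uparrow\beta^*$. (c) For every non-decreasing sequence $(\beta_n)\subseteq(\alpha,\beta^*)$ with $\beta_n\to\beta^*$, the forms $(1-5^{-1}\cdot2^{\beta_n})E_{\beta_n}$ and $\mathfrak E_{\mathrm{loc}}$ are closed forms on $L^2(K;\nu)$, and $(1-5^{-1}\cdot2^{\beta_n})E_{\beta_n}\to\mathfrak E_{\mathrm{loc}}$ in the sense of Mosco. -/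

import Mathlib

open Filter Topology MeasureTheory
open scoped ENNReal NNReal

namespace Gasket

/-! ### The Sierpinski gasket -/

/-- The corner points `p₀ = (0,0)`, `p₁ = (1,0)`, `p₂ = (1/2, √3/2)`. -/
noncomputable def corner : Fin 3 → EuclideanSpace ℝ (Fin 2) :=
  ![!₂[0, 0], !₂[1, 0], !₂[1 / 2, Real.sqrt 3 / 2]]

/-- The contractions `fᵢ(x) = (x + pᵢ) / 2` of the plane. -/
noncomputable def contr (i : Fin 3) (x : EuclideanSpace ℝ (Fin 2)) : EuclideanSpace ℝ (Fin 2) :=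
  (1 / 2 : ℝ) • (x + corner i)

/-- The vertex sets `V₀ = {p₀, p₁, p₂}`, `Vₙ₊₁ = f₀(Vₙ) ∪ f₁(Vₙ) ∪ f₂(Vₙ)`. -/
noncomputable def vertexSet : ℕ → Set (EuclideanSpace ℝ (Fin 2))
  | 0 => Set.range corner
  | n + 1 => ⋃ i, contr i '' vertexSet n

/-- The Sierpinski gasket `K`, as the closure of `⋃ₙ Vₙ`. By `eq_gasket_iff` below it is the
unique non-empty compact set with `K = f₀(K) ∪ f₁(K) ∪ f₂(K)`. -/
noncomputable def gasket : Set (EuclideanSpace ℝ (Fin 2)) := closure (⋃ n, vertexSet n)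

theorem dist_contr (i : Fin 3) (x y : EuclideanSpace ℝ (Fin 2)) :
    dist (contr i x) (contr i y) = dist x y / 2 := by
  simp only [contr, dist_smul₀, dist_add_right]
  norm_num
  ring

theorem contr_corner (i : Fin 3) : contr i (corner i) = corner i := by
  rw [contr, ← two_smul ℝ (corner i), smul_smul]
  norm_num

theorem vertexSet_subset_succ (n : ℕ) : vertexSet n ⊆ vertexSet (n + 1) := by
  induction n with
  | zero =>
    rintro _ ⟨i, rfl⟩
    exact Set.mem_iUnion.2 ⟨i, corner i, ⟨i, rfl⟩, contr_corner i⟩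
  | succ n ih => exact Set.iUnion_mono fun i => Set.image_mono ih

theorem isClosedEmbedding_contr (i : Fin 3) : IsClosedEmbedding (contr i) := by
  have h : AntilipschitzWith 2 (contr i) :=
    AntilipschitzWith.of_le_mul_dist fun x y => by rw [dist_contr]; simp; linarith
  have h' : LipschitzWith 1 (contr i) :=
    LipschitzWith.of_dist_le_mul fun x y => by
      rw [dist_contr]; simp [dist_nonneg (x := x) (y := y)]
  exact h.isClosedEmbedding h'.uniformContinuous

theorem gasket_eq_iUnion : gasket = ⋃ i, contr i '' gasket := by
  have h1 : (⋃ n, vertexSet n) = ⋃ i, contr i '' ⋃ n, vertexSet n := by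
    apply Set.Subset.antisymm
    · refine Set.iUnion_subset fun n x hx => ?_
      obtain ⟨i, y, hy, rfl⟩ := Set.mem_iUnion.1 (vertexSet_subset_succ n hx)
      exact Set.mem_iUnion.2 ⟨i, y, Set.mem_iUnion.2 ⟨n, hy⟩, rfl⟩
    · refine Set.iUnion_subset fun i => ?_
      rintro _ ⟨y, hy, rfl⟩
      obtain ⟨n, hn⟩ := Set.mem_iUnion.1 hy
      exact Set.mem_iUnion.2 ⟨n + 1, Set.mem_iUnion.2 ⟨i, y, hn, rfl⟩⟩
  unfold gasket
  conv_lhs => rw [h1]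
  rw [closure_iUnion_of_finite]
  exact Set.iUnion_congr fun i => ((isClosedEmbedding_contr i).closure_image_eq _)

theorem corner_mem (i : Fin 3) : corner i ∈ gasket :=
  subset_closure (Set.mem_iUnion.2 ⟨0, i, rfl⟩)

theorem contr_mem (i : Fin 3) {x : EuclideanSpace ℝ (Fin 2)} (hx : x ∈ gasket) :
    contr i x ∈ gasket := by
  rw [gasket_eq_iUnion]
  exact Set.mem_iUnion.2 ⟨i, x, hx, rfl⟩

theorem norm_corner_le (i : Fin 3) : ‖corner i‖ ≤ 1 := by
  rw [EuclideanSpace.norm_eq, Real.sqrt_le_one]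
  fin_cases i <;> (simp [corner, div_pow]; try norm_num)

theorem isCompact_gasket : IsCompact gasket := by
  have h : ∀ n, vertexSet n ⊆ Metric.closedBall 0 1 := by
    intro n
    induction n with
    | zero => rintro _ ⟨i, rfl⟩; simpa using norm_corner_le i
    | succ n ih =>
      refine Set.iUnion_subset fun i => ?_
      rintro _ ⟨y, hy, rfl⟩
      have h1 := ih hy
      have h2 := norm_add_le y (corner i)
      have h3 := norm_corner_le i
      simp only [mem_closedBall_zero_iff, contr, norm_smul] at h1 ⊢
      norm_num
      linarith
  exact (isCompact_closedBall _ _).of_isClosed_subset isClosed_closure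
    (closure_minimal (Set.iUnion_subset h) Metric.isClosed_closedBall)

theorem subset_of_selfSimilar {A B : Set (EuclideanSpace ℝ (Fin 2))} (hA : IsCompact A)
    (hA' : A = ⋃ i, contr i '' A) (hB : IsCompact B) (hBne : B.Nonempty)
    (hB' : B = ⋃ i, contr i '' B) : A ⊆ B := by
  rcases A.eq_empty_or_nonempty with rfl | hAne
  · simp
  obtain ⟨x, hx, hmax⟩ := hA.exists_isMaxOn hAne (Metric.continuous_infDist_pt B).continuousOn
  rw [hA'] at hx
  obtain ⟨i, y, hy, rfl⟩ := Set.mem_iUnion.1 hx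
  obtain ⟨z, hz, hyz⟩ := hB.exists_infDist_eq_dist hBne y
  have h1 : Metric.infDist (contr i y) B ≤ dist (contr i y) (contr i z) :=
    Metric.infDist_le_dist_of_mem (by rw [hB']; exact Set.mem_iUnion.2 ⟨i, z, hz, rfl⟩)
  rw [dist_contr, ← hyz] at h1
  have h2 : Metric.infDist y B ≤ Metric.infDist (contr i y) B := hmax hy
  intro w hw
  have h3 : Metric.infDist w B ≤ Metric.infDist (contr i y) B := hmax hw
  have h4 := Metric.infDist_nonneg (x := w) (s := B)
  exact (hB.isClosed.mem_iff_infDist_zero hBne).2 (by linarith)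

theorem eq_gasket_iff (A : Set (EuclideanSpace ℝ (Fin 2))) :
    A = gasket ↔ A.Nonempty ∧ IsCompact A ∧ A = ⋃ i, contr i '' A := by
  constructor
  · rintro rfl
    exact ⟨⟨_, corner_mem 0⟩, isCompact_gasket, gasket_eq_iUnion⟩
  · rintro ⟨h1, h2, h3⟩
    exact (subset_of_selfSimilar h2 h3 isCompact_gasket ⟨_, corner_mem 0⟩ gasket_eq_iUnion).antisymm
      (subset_of_selfSimilar isCompact_gasket gasket_eq_iUnion h2 h1 h3)

/-- The gasket as a metric space, with the Euclidean distance. -/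
abbrev K : Type := gasket

/-- The corner points as points of `K`. -/
noncomputable def p (i : Fin 3) : K := ⟨corner i, corner_mem i⟩

/-- The maps `fᵢ : K → K`. -/
noncomputable def f (i : Fin 3) (x : K) : K := ⟨contr i x, contr_mem i x.2⟩

/-- `f_w = f_{w₁} ∘ ⋯ ∘ f_{wₙ}` for a word `w = w₁ … wₙ` of length `n` over `{0, 1, 2}`. -/
noncomputable def wordMap : (n : ℕ) → (Fin n → Fin 3) → K → K
  | 0, _ => id
  | n + 1, w => f (w 0) ∘ wordMap n (Fin.tail w)

/-- The Hausdorff dimension `α = log 3 / log 2` of the gasket. -/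
noncomputable def α : ℝ := Real.log 3 / Real.log 2

/-- The walk dimension `β* = log 5 / log 2` of the gasket. -/
noncomputable def βstar : ℝ := Real.log 5 / Real.log 2

/-- The normalized `α`-dimensional Hausdorff measure on `K`. -/
noncomputable def ν : Measure K :=
  ((Measure.hausdorffMeasure α : Measure K) Set.univ)⁻¹ • Measure.hausdorffMeasure α

/-- The Hilbert space `L²(K; ν)`. -/
abbrev L2 : Type := Lp ℝ 2 ν

/-! ### The energies of a function on `K` -/

/-- `∑_{w ∈ Wₙ} ∑_{a, b ∈ V_w} (u(a) - u(b))²`, where `V_w = {f_w(p₀), f_w(p₁), f_w(p₂)}`. -/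
noncomputable def cellSum (n : ℕ) (u : K → ℝ) : ℝ :=
  ∑ w : Fin n → Fin 3, ∑ i : Fin 3, ∑ j : Fin 3,
    (u (wordMap n w (p i)) - u (wordMap n w (p j))) ^ 2

/-- `E_β(u,u) = ∑_{n ≥ 1} 2^{(β - α) n} ∑_{w ∈ Wₙ} ∑_{a, b ∈ V_w} (u(a) - u(b))² ∈ [0, ∞]`. -/
noncomputable def discreteEnergy (β : ℝ) (u : K → ℝ) : ℝ≥0∞ :=
  ∑' n : ℕ, ENNReal.ofReal ((2 : ℝ) ^ ((β - α) * ((n + 1 : ℕ) : ℝ)) * cellSum (n + 1) u)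

/-- `ℰ_β(u,u) = ∫_K ∫_K (u(x) - u(y))² / |x - y|^{α + β} ν(dx) ν(dy) ∈ [0, ∞]`. -/
noncomputable def stableEnergy (β : ℝ) (u : K → ℝ) : ℝ≥0∞ :=
  ∫⁻ y, ∫⁻ x, ENNReal.ofReal ((u x - u y) ^ 2 / dist x y ^ (α + β)) ∂ν ∂ν

/-- `𝔈ₙ(u,u) = (5/3)ⁿ ∑_{w ∈ Wₙ} ∑_{a, b ∈ V_w} (u(a) - u(b))²`. -/
noncomputable def levelEnergy (n : ℕ) (u : K → ℝ) : ℝ≥0∞ :=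
  ENNReal.ofReal ((5 / 3 : ℝ) ^ n * cellSum n u)

/-- Kigami's energy `𝔈_loc(u,u) = limₙ 𝔈ₙ(u,u) ∈ [0, ∞]`; the limit exists by
`tendsto_levelEnergy` below. -/
noncomputable def localEnergy (u : K → ℝ) : ℝ≥0∞ :=
  limUnder atTop fun n => levelEnergy n u

theorem f_p_comm (i j : Fin 3) : f i (p j) = f j (p i) :=
  Subtype.ext (by simp only [f, p, contr, add_comm])

theorem f_p_self (i : Fin 3) : f i (p i) = p i :=
  Subtype.ext (contr_corner i)

theorem cellSum_succ (n : ℕ) (u : K → ℝ) : cellSum (n + 1) u = ∑ k, cellSum n (u ∘ f k) := by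
  unfold cellSum
  rw [← (Fin.consEquiv fun _ : Fin (n + 1) => Fin 3).sum_comp, Fintype.sum_prod_type]
  rfl

theorem cellSum_le_succ (n : ℕ) (u : K → ℝ) : cellSum n u ≤ 5 / 3 * cellSum (n + 1) u := by
  induction n generalizing u with
  | zero =>
    rw [cellSum_succ]
    simp only [cellSum, wordMap, Fin.sum_univ_three, Finset.univ_unique, Finset.sum_singleton,
      Function.comp_apply, id_eq, f_p_self, f_p_comm 1 0, f_p_comm 2 0, f_p_comm 2 1]
    generalize u (p 0) = a
    generalize u (p 1) = b
    generalize u (p 2) = c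
    generalize u (f 0 (p 1)) = x
    generalize u (f 1 (p 2)) = y
    generalize u (f 0 (p 2)) = z
    nlinarith [sq_nonneg (5 * x - 2 * a - 2 * b - c), sq_nonneg (5 * y - 2 * b - 2 * c - a),
      sq_nonneg (5 * z - 2 * a - 2 * c - b),
      sq_nonneg ((5 * x - 2 * a - 2 * b - c) - (5 * y - 2 * b - 2 * c - a)),
      sq_nonneg ((5 * y - 2 * b - 2 * c - a) - (5 * z - 2 * a - 2 * c - b)),
      sq_nonneg ((5 * z - 2 * a - 2 * c - b) - (5 * x - 2 * a - 2 * b - c))]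
  | succ n ih =>
    rw [cellSum_succ n, cellSum_succ (n + 1), Finset.mul_sum]
    exact Finset.sum_le_sum fun k _ => ih _

theorem monotone_levelEnergy (u : K → ℝ) : Monotone fun n => levelEnergy n u := by
  refine monotone_nat_of_le_succ fun n => ENNReal.ofReal_le_ofReal ?_
  rw [pow_succ, mul_assoc]
  exact mul_le_mul_of_nonneg_left (cellSum_le_succ n u) (by positivity)

theorem tendsto_levelEnergy (u : K → ℝ) :
    Tendsto (fun n => levelEnergy n u) atTop (𝓝 (localEnergy u)) :=
  tendsto_nhds_limUnder ⟨_, tendsto_atTop_iSup (monotone_levelEnergy u)⟩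

open Classical in
/-- The extension to `L²(K; ν)` of an energy given on `C(K)`: if `u` has a (necessarily unique)
continuous version, it is the energy of that version, and otherwise it is `+∞`. -/
noncomputable def extend (E : (K → ℝ) → ℝ≥0∞) (u : L2) : ℝ≥0∞ :=
  if h : ∃ v : C(K, ℝ), ⇑u =ᵐ[ν] ⇑v then E h.choose else ⊤

/-- The form `(1 - 5⁻¹ 2^β) E_β(u,u)` on `L²(K; ν)`. -/
noncomputable def scaledForm (β : ℝ) (u : L2) : ℝ≥0∞ :=
  ENNReal.ofReal (1 - (5 : ℝ)⁻¹ * (2 : ℝ) ^ β) * extend (discreteEnergy β) u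

/-- Kigami's energy `𝔈_loc(u,u)` on `L²(K; ν)`. -/
noncomputable def localForm (u : L2) : ℝ≥0∞ := extend localEnergy u

/-! ### Closed forms and Mosco convergence -/

section Forms

variable {H : Type*} [NormedAddCommGroup H] [InnerProductSpace ℝ H]

/-- `u ↦ E u ∈ [0, ∞]` is the diagonal of a closed symmetric form on `H`, extended by `+∞` outside
the domain: there are a dense subspace `D` and a symmetric non-negative bilinear form `B` on `D`
with `E u = B u u` on `D` and `E u = ∞` off `D`, such that `D` is complete for
`B u v + ⟪u, v⟫`. -/
def IsClosedForm (E : H → ℝ≥0∞) : Prop :=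
  ∃ (D : Submodule ℝ H) (B : D →ₗ[ℝ] D →ₗ[ℝ] ℝ),
    Dense (D : Set H) ∧
    (∀ u v : D, B u v = B v u) ∧
    (∀ u : D, 0 ≤ B u u) ∧
    (∀ u : D, E u = ENNReal.ofReal (B u u)) ∧
    (∀ u : H, u ∉ D → E u = ⊤) ∧
    ∀ s : ℕ → D,
      (∀ ε > 0, ∃ N, ∀ m ≥ N, ∀ n ≥ N,
        B (s m - s n) (s m - s n) + ‖((s m - s n : D) : H)‖ ^ 2 < ε) →
      ∃ v : D, Tendsto (fun n => B (s n - v) (s n - v) + ‖((s n - v : D) : H)‖ ^ 2) atTop (𝓝 0)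

/-- Weak convergence of a sequence in a Hilbert space. -/
def WeaklyConverges (u : ℕ → H) (v : H) : Prop :=
  ∀ w : H, Tendsto (fun n => inner ℝ (u n) w) atTop (𝓝 (inner ℝ v w))

/-- Mosco convergence of a sequence of closed forms `Eₙ` to a closed form `E`. -/
structure MoscoConverges (En : ℕ → H → ℝ≥0∞) (E : H → ℝ≥0∞) : Prop where
  isClosedForm_seq : ∀ n, IsClosedForm (En n)
  isClosedForm_limit : IsClosedForm E
  le_liminf : ∀ (u : ℕ → H) (v : H), WeaklyConverges u v →
    E v ≤ liminf (fun n => En n (u n)) atTop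
  limsup_le : ∀ v : H, ∃ u : ℕ → H, Tendsto u atTop (𝓝 v) ∧
    limsup (fun n => En n (u n)) atTop ≤ E v

end Forms

end Gasket

namespace Gasket

/-! ### Words -/

/-! Comparison (a). Put t = 2^(β-α), so that 2^(α+β) = 9t. Splitting the kernel over dyadic shells
makes ℰ_β comparable to ∑ (9t)^n I_n, where I_n is the integral of (u(x) - u(y))² over |x - y| ≤
2⁻ⁿ. Points at distance at most 2^(-n-1) lie in level-n cells that share a vertex
(`adj_of_dist_le`), and each cell has at most nine such neighbours. Passing through the shared
vertex reduces I_{n+1} to integrals of (u(x) - vertex value)² over cells. These are telescoped along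
finer vertices; averaging over the three subcells beats the factor 2 of (a+b)² ≤ 2a² + 2b², leaving
the ratio 2/3. Conversely a vertex value is the limit of the averages of u over cells shrinking to
it. Here only one subcell is followed and no averaging helps, so the telescoping uses (a+b)² ≤ s a²
+ s/(s-1) b² with 1 < s < t, and the loss s^m is absorbed by t^m. Both directions end with the same
geometric convolution estimate, `tsum_tsum_shift_le`.

Monotonicity (b). With r = 5⁻¹·2^β one has E_β = ∑_{n≥1} r^n 𝔈_n, and 𝔈_n is non-decreasing in n.
Abel summation gives (1 - r) E_β = ∑ r^(k+1) δ_k, where the δ_k ≥ 0 are the increments of 𝔈_n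
(`scaledEnergy_eq`). This power series with non-negative coefficients is monotone in r and tends as
r ↑ 1 to ∑ δ_k = lim 𝔈_n.

Mosco convergence (c). By (b) the forms increase to their limit. The upper condition holds with
constant sequences. For the lower one fix β < β*: eventually the n-th form dominates the form at β,
which is weakly lower semicontinuous, and then β ↑ β*. Lower semicontinuity comes from a Morrey-type
estimate: a bound on E_β gives a uniform modulus of continuity (`exists_modulus`), so Arzelà–Ascoli
yields a uniformly convergent subsequence whose limit is the weak limit. Closedness follows from
lower semicontinuity and density of the domain (`isClosedForm_extend`); density is obtained from
piecewise harmonic functions.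

All of this rests on ν being a self-similar probability measure of full support. The Hausdorff
measure is bounded above by covering with cells and below by comparison with the Bernoulli measure
on addresses. -/

theorem sum_word_succ {M : Type*} [AddCommMonoid M] (n : ℕ) (F : (K → K) → M) :
    ∑ w : Fin (n + 1) → Fin 3, F (wordMap (n + 1) w) =
      ∑ k, ∑ w : Fin n → Fin 3, F (f k ∘ wordMap n w) := by
  rw [← (Fin.consEquiv fun _ : Fin (n + 1) => Fin 3).sum_comp, Fintype.sum_prod_type]
  rfl

/-- Here the last letter of the word is split off, refining each cell, instead of the first. -/
theorem sum_word_succ' {M : Type*} [AddCommMonoid M] (n : ℕ) (F : (K → K) → M) :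
    ∑ w : Fin (n + 1) → Fin 3, F (wordMap (n + 1) w) =
      ∑ w : Fin n → Fin 3, ∑ k, F (wordMap n w ∘ f k) := by
  induction n generalizing F with
  | zero =>
    rw [sum_word_succ]
    simp [wordMap]
  | succ n ih =>
    rw [sum_word_succ, sum_word_succ n fun h => ∑ k, F (h ∘ f k)]
    exact Finset.sum_congr rfl fun k _ => ih fun h => F (f k ∘ h)

theorem continuous_f (i : Fin 3) : Continuous (f i) :=
  ((isClosedEmbedding_contr i).continuous.comp continuous_subtype_val).subtype_mk _

theorem continuous_wordMap (n : ℕ) (w : Fin n → Fin 3) : Continuous (wordMap n w) := by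
  induction n with
  | zero => exact continuous_id
  | succ n ih => exact (continuous_f _).comp (ih _)

theorem dist_f (i : Fin 3) (x y : K) : dist (f i x) (f i y) = dist x y / 2 :=
  dist_contr i x y

theorem dist_wordMap (n : ℕ) (w : Fin n → Fin 3) (x y : K) :
    dist (wordMap n w x) (wordMap n w y) = dist x y / 2 ^ n := by
  induction n with
  | zero => simp [wordMap]
  | succ n ih =>
    change dist (f _ (wordMap n _ x)) (f _ (wordMap n _ y)) = _
    rw [dist_f, ih, pow_succ, div_div]

theorem f_injective (i : Fin 3) : Function.Injective (f i) := fun x y h => by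
  have := dist_f i x y
  rw [h, dist_self] at this
  exact dist_eq_zero.1 (by linarith)

instance : CompactSpace K := isCompact_iff_compactSpace.1 isCompact_gasket

instance : Nonempty K := ⟨p 0⟩

theorem exists_f_eq (x : K) : ∃ i y, f i y = x := by
  obtain ⟨i, y, hy, h⟩ := Set.mem_iUnion.1 (gasket_eq_iUnion.subset x.2)
  exact ⟨i, ⟨y, hy⟩, Subtype.ext h⟩

theorem exists_wordMap_eq (n : ℕ) (x : K) : ∃ w y, wordMap n w y = x := by
  induction n generalizing x with
  | zero => exact ⟨Fin.elim0, x, rfl⟩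
  | succ n ih =>
    obtain ⟨i, y, rfl⟩ := exists_f_eq x
    obtain ⟨w, z, rfl⟩ := ih y
    exact ⟨Fin.cons i w, z, by simp [wordMap]⟩

/-! ### Barycentric coordinates -/

/-- The barycentric coordinates of a point of the plane with respect to the three corners. -/
noncomputable def bary (i : Fin 3) (x : EuclideanSpace ℝ (Fin 2)) : ℝ :=
  ![1 - x 0 - x 1 / √3, x 0 - x 1 / √3, 2 * x 1 / √3] i

theorem sum_bary (x : EuclideanSpace ℝ (Fin 2)) : ∑ i, bary i x = 1 := by
  simp only [bary, Fin.sum_univ_three, Matrix.cons_val]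
  ring

theorem bary_corner (i j : Fin 3) : bary i (corner j) = if i = j then 1 else 0 := by
  have h : √3 ≠ 0 := by positivity
  fin_cases i <;> fin_cases j <;> simp [bary, corner] <;> field_simp <;> norm_num

theorem bary_contr (i j : Fin 3) (x : EuclideanSpace ℝ (Fin 2)) :
    bary i (contr j x) = (bary i x + if i = j then 1 else 0) / 2 := by
  rw [← bary_corner i j]
  fin_cases i <;> simp [bary, contr] <;> ring

theorem continuous_bary (i : Fin 3) : Continuous (bary i) := by
  have h : Continuous fun x : EuclideanSpace ℝ (Fin 2) =>
      ![1 - x 0 - x 1 / √3, x 0 - x 1 / √3, 2 * x 1 / √3] i := by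
    fin_cases i <;> dsimp <;> fun_prop
  exact h

theorem bary_nonneg (i : Fin 3) {x : EuclideanSpace ℝ (Fin 2)} (hx : x ∈ gasket) :
    0 ≤ bary i x := by
  have h : ∀ n, vertexSet n ⊆ {x | 0 ≤ bary i x} := by
    intro n
    induction n with
    | zero =>
      rintro _ ⟨j, rfl⟩
      simp only [Set.mem_ofPred_eq, bary_corner]
      split_ifs <;> norm_num
    | succ n ih =>
      refine Set.iUnion_subset fun j => ?_
      rintro _ ⟨y, hy, rfl⟩
      have := ih hy
      simp only [Set.mem_ofPred_eq, bary_contr] at this ⊢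
      split_ifs <;> linarith
  exact closure_minimal (Set.iUnion_subset h)
    (isClosed_le continuous_const (continuous_bary i)) hx

theorem bary_le_one (i : Fin 3) {x : EuclideanSpace ℝ (Fin 2)} (hx : x ∈ gasket) :
    bary i x ≤ 1 := by
  rw [← sum_bary x]
  exact Finset.single_le_sum (f := fun i => bary i x) (fun j _ => bary_nonneg j hx)
    (Finset.mem_univ i)

/-- The exact Lipschitz constant is 2/√3. The rational bound 3/2 is good enough, since
`adj_of_dist_le` only needs a constant below 2. -/
theorem abs_bary_sub_le (i : Fin 3) (x y : EuclideanSpace ℝ (Fin 2)) :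
    |bary i x - bary i y| ≤ 3 / 2 * dist x y := by
  have h3 : √3 ^ 2 = 3 := Real.sq_sqrt (by norm_num)
  have hd : dist x y ^ 2 = (x 0 - y 0) ^ 2 + (x 1 - y 1) ^ 2 := by
    rw [EuclideanSpace.dist_eq, Real.sq_sqrt (by positivity)]
    simp [Real.dist_eq]
  refine abs_le_of_sq_le_sq ?_ (by positivity)
  rw [mul_pow, hd]
  set a := x 0 - y 0 with ha
  obtain ⟨b, hb⟩ : ∃ b, b = (x 1 - y 1) / √3 := ⟨_, rfl⟩
  have hb2 : (x 1 - y 1) ^ 2 = 3 * b ^ 2 := by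
    rw [hb, div_pow, h3]; ring
  rw [hb2]
  fin_cases i
  · have : bary 0 x - bary 0 y = -(a + b) := by simp [bary, ha, hb]; ring
    simp only [Fin.zero_eta, this]
    nlinarith [sq_nonneg (a - 3 * b), sq_nonneg a, sq_nonneg b]
  · have : bary 1 x - bary 1 y = a - b := by simp [bary, ha, hb]; ring
    simp only [Fin.mk_one, this]
    nlinarith [sq_nonneg (a + 3 * b), sq_nonneg a, sq_nonneg b]
  · have : bary 2 x - bary 2 y = 2 * b := by simp [bary, hb]; ring
    simp only [Fin.reduceFinMk, this]
    nlinarith [sq_nonneg a, sq_nonneg b]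

theorem bary_injective {x y : EuclideanSpace ℝ (Fin 2)} (h : ∀ i, bary i x = bary i y) :
    x = y := by
  have h1 := h 1
  have h2 := h 2
  simp only [bary, Matrix.cons_val] at h1 h2
  have h3 : √3 ≠ 0 := by positivity
  field_simp at h1 h2
  ext i
  fin_cases i
  · simp only [Fin.zero_eta]
    have : x 1 = y 1 := by linarith
    rw [this] at h1
    exact mul_right_cancel₀ h3 (by linarith)
  · simp only [Fin.mk_one]; linarith

theorem dist_corner_le (i j : Fin 3) : dist (corner i) (corner j) ≤ 1 := by
  rw [EuclideanSpace.dist_eq, Real.sqrt_le_one]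
  have h3 : √3 ^ 2 = 3 := Real.sq_sqrt (by norm_num)
  fin_cases i <;> fin_cases j <;> simp [corner, Real.dist_eq, div_pow] <;> norm_num

theorem dist_f_f (i j : Fin 3) (x : K) : dist (f i x) (f j x) ≤ 1 / 2 := by
  have h : dist (f i x) (f j x) = dist (corner i) (corner j) / 2 := by
    change dist (contr i x) (contr j x) = _
    simp only [contr, dist_smul₀, dist_add_left]
    norm_num
    ring
  rw [h]
  linarith [dist_corner_le i j]

/-- Self-similarity at a pair realizing the diameter D: translating from one subcell to the other
costs at most 1/2 and the rest is halved, so D ≤ D/2 + 1/2. -/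
theorem dist_le_one (x y : K) : dist x y ≤ 1 := by
  have hc : Continuous fun q : K × K => dist q.1 q.2 := continuous_dist
  obtain ⟨⟨z1, z2⟩, -, hz⟩ := isCompact_univ.exists_isMaxOn Set.univ_nonempty hc.continuousOn
  have hmax : ∀ x y : K, dist x y ≤ dist z1 z2 := fun x y =>
    isMaxOn_iff.1 hz (x, y) (Set.mem_univ _)
  clear hz
  obtain ⟨i, a, rfl⟩ := exists_f_eq z1
  obtain ⟨j, b, rfl⟩ := exists_f_eq z2
  have h1 := dist_triangle (f i a) (f i b) (f j b)
  have h2 := dist_f_f i j b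
  have h3 := dist_f i a b
  have h4 := hmax a b
  have h5 := hmax x y
  linarith

/-- The position of the cell `f_w(K)` in the triangular lattice of mesh `2⁻ⁿ`. -/
def wordIndex : (n : ℕ) → (Fin n → Fin 3) → Fin 3 → ℕ
  | 0, _, _ => 0
  | n + 1, w, i => wordIndex n (Fin.tail w) i + if i = w 0 then 2 ^ n else 0

theorem bary_wordMap (n : ℕ) (w : Fin n → Fin 3) (i : Fin 3) (x : K) :
    bary i (wordMap n w x) = (wordIndex n w i + bary i x) / 2 ^ n := by
  induction n with
  | zero => simp [wordMap, wordIndex]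
  | succ n ih =>
    change bary i (contr (w 0) (wordMap n _ x)) = _
    rw [bary_contr, ih]
    simp only [wordIndex]
    split_ifs <;> push_cast <;> field_simp <;> ring

theorem sum_wordIndex (n : ℕ) (w : Fin n → Fin 3) : ∑ i, wordIndex n w i + 1 = 2 ^ n := by
  induction n with
  | zero => simp [wordIndex]
  | succ n ih =>
    simp only [wordIndex, Finset.sum_add_distrib, Finset.sum_ite_eq', Finset.mem_univ, if_true]
    have := ih (Fin.tail w)
    rw [pow_succ]
    omega

theorem wordIndex_lt (n : ℕ) (w : Fin n → Fin 3) (i : Fin 3) : wordIndex n w i < 2 ^ n := by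
  rw [← sum_wordIndex n w]
  exact Nat.lt_succ_of_le (Finset.single_le_sum (fun _ _ => Nat.zero_le _) (Finset.mem_univ i))

/-- The coordinates are binary expansions of the word: the first letter is the only coordinate that
reaches 2ⁿ, so it can be read off and removed. -/
theorem wordIndex_injective (n : ℕ) : Function.Injective (wordIndex n) := by
  induction n with
  | zero => exact fun w w' _ => Subsingleton.elim _ _
  | succ n ih =>
    intro w w' h
    have h0 : w 0 = w' 0 := by
      by_contra hne
      have := congrFun h (w 0)
      simp only [wordIndex, if_true, if_neg hne] at this
      have := wordIndex_lt n (Fin.tail w') (w 0)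
      omega
    have h1 : Fin.tail w = Fin.tail w' := ih <| funext fun i => by
      have := congrFun h i
      simp only [wordIndex, h0] at this
      omega
    rw [← Fin.cons_self_tail w, ← Fin.cons_self_tail w', h0, h1]

/-- Two cells of level `n` are adjacent if they share a vertex. -/
def Adj (n : ℕ) (w w' : Fin n → Fin 3) : Prop :=
  ∃ i j, wordMap n w (p i) = wordMap n w' (p j)

theorem Adj.symm {n : ℕ} {w w' : Fin n → Fin 3} (h : Adj n w w') : Adj n w' w := by
  obtain ⟨i, j, h⟩ := h
  exact ⟨j, i, h.symm⟩

/-- Turns coincidence of vertices into an identity between integer lattice positions. -/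
theorem wordMap_p_eq_iff (n : ℕ) (w w' : Fin n → Fin 3) (i j : Fin 3) :
    wordMap n w (p i) = wordMap n w' (p j) ↔
      ∀ k, (wordIndex n w k + if k = i then 1 else 0) =
        wordIndex n w' k + if k = j then 1 else 0 := by
  have key : ∀ k, (bary k (wordMap n w (p i)) = bary k (wordMap n w' (p j)) ↔
      (wordIndex n w k + if k = i then 1 else 0) =
        wordIndex n w' k + if k = j then 1 else 0) := by
    intro k
    have h1 : bary k (p i) = if k = i then 1 else 0 := bary_corner k i
    have h2 : bary k (p j) = if k = j then 1 else 0 := bary_corner k j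
    rw [bary_wordMap, bary_wordMap, div_left_inj' (by positivity), h1, h2]
    constructor
    · intro h
      have : (((wordIndex n w k + if k = i then 1 else 0 : ℕ) : ℝ)) =
        ((wordIndex n w' k + if k = j then 1 else 0 : ℕ) : ℝ) := by push_cast; exact h
      exact_mod_cast this
    · intro h
      exact_mod_cast h
  constructor
  · intro h k
    rw [← key, h]
  · intro h
    exact Subtype.ext (bary_injective fun k => (key k).2 (h k))

open Classical in
-- The pair of corners that are glued determines the lattice position of the neighbour, hence the
-- neighbour; there are nine pairs.
theorem card_adj_le (n : ℕ) (w : Fin n → Fin 3) :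
    (Finset.univ.filter fun w' => Adj n w w').card ≤ 9 := by
  have h : ∀ w' : Fin n → Fin 3, ∃ c : Fin 3 × Fin 3, Adj n w w' →
      wordMap n w (p c.1) = wordMap n w' (p c.2) := by
    intro w'
    by_cases h : Adj n w w'
    · obtain ⟨i, j, h⟩ := h
      exact ⟨(i, j), fun _ => h⟩
    · exact ⟨(0, 0), fun h' => (h h').elim⟩
  choose c hc using h
  have h9 : (Finset.univ : Finset (Fin 3 × Fin 3)).card = 9 := by simp
  rw [← h9]
  refine Finset.card_le_card_of_injOn c (fun _ _ => Finset.mem_univ _) ?_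
  intro a ha b hb hab
  have ha := hc a (by simpa using ha)
  have hb := hc b (by simpa using hb)
  rw [← hab] at hb
  rw [wordMap_p_eq_iff] at ha hb
  exact wordIndex_injective n (funext fun k => by have := ha k; have := hb k; omega)

/-- A vector in {-1, 0, 1}³ with sum zero is either zero or has exactly one entry 1 and one entry
-1. -/
theorem exists_shift_eq {a b : Fin 3 → ℕ} (h : ∀ k, |(a k : ℤ) - b k| ≤ 1)
    (hs : ∑ i, a i = ∑ i, b i) :
    ∃ i j : Fin 3, ∀ k, (a k + if k = i then 1 else 0) = b k + if k = j then 1 else 0 := by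
  have k0 := abs_le.1 (h 0)
  have k1 := abs_le.1 (h 1)
  have k2 := abs_le.1 (h 2)
  simp only [Fin.sum_univ_three] at hs
  have hex : ∀ i j : Fin 3, (∀ k, (a k + if k = i then 1 else 0) = b k + if k = j then 1 else 0) ↔
      ((a 0 + if 0 = i then 1 else 0) = b 0 + if 0 = j then 1 else 0) ∧
      ((a 1 + if 1 = i then 1 else 0) = b 1 + if 1 = j then 1 else 0) ∧
      ((a 2 + if 2 = i then 1 else 0) = b 2 + if 2 = j then 1 else 0) := fun i j =>
    ⟨fun h => ⟨h 0, h 1, h 2⟩, fun h k => by fin_cases k; exacts [h.1, h.2.1, h.2.2]⟩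
  simp only [hex]
  rcases lt_trichotomy (a 0) (b 0) with h0 | h0 | h0 <;>
  rcases lt_trichotomy (a 1) (b 1) with h1 | h1 | h1 <;>
  rcases lt_trichotomy (a 2) (b 2) with h2 | h2 | h2 <;>
  first
  | omega
  | exact ⟨0, 0, by simp; omega⟩
  | exact ⟨0, 1, by simp; omega⟩
  | exact ⟨0, 2, by simp; omega⟩
  | exact ⟨1, 0, by simp; omega⟩
  | exact ⟨1, 2, by simp; omega⟩
  | exact ⟨2, 0, by simp; omega⟩
  | exact ⟨2, 1, by simp; omega⟩

/-- After scaling by 2ⁿ the barycentric coordinates differ by at most 3/2 · 1/2 = 3/4, and the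
fractional positions inside the cells by at most 1. The integer positions therefore differ by less
than 2, so by at most 1, and have the same sum. -/
theorem adj_of_dist_le {n : ℕ} {w w' : Fin n → Fin 3} {x y : K}
    (h : dist (wordMap n w x) (wordMap n w' y) ≤ (1 / 2) ^ (n + 1)) : Adj n w w' := by
  have key : ∀ k, |(wordIndex n w k : ℤ) - wordIndex n w' k| ≤ 1 := by
    intro k
    have h1 := (abs_bary_sub_le k (wordMap n w x) (wordMap n w' y)).trans
      (mul_le_mul_of_nonneg_left h (by norm_num))
    have e : ((wordIndex n w k + bary k x) / 2 ^ n - (wordIndex n w' k + bary k y) / 2 ^ n : ℝ) =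
      ((wordIndex n w k + bary k x) - (wordIndex n w' k + bary k y)) / 2 ^ n := by ring
    rw [bary_wordMap, bary_wordMap, e, abs_div, abs_of_pos (by positivity : (0 : ℝ) < 2 ^ n),
      div_le_iff₀ (by positivity)] at h1
    have h2 : 3 / 2 * (1 / 2 : ℝ) ^ (n + 1) * 2 ^ n = 3 / 4 := by
      rw [pow_succ, one_div, inv_pow]
      field_simp
      norm_num
    rw [h2] at h1
    have b1 := bary_nonneg k x.2
    have b2 := bary_nonneg k y.2
    have b3 := bary_le_one k x.2
    have b4 := bary_le_one k y.2
    rw [abs_le] at h1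
    have h3 : (((wordIndex n w k : ℤ) - wordIndex n w' k : ℤ) : ℝ) < 2 := by
      push_cast; linarith
    have h4 : (-2 : ℝ) < (((wordIndex n w k : ℤ) - wordIndex n w' k : ℤ) : ℝ) := by
      push_cast; linarith
    have h3 : (wordIndex n w k : ℤ) - wordIndex n w' k < 2 := by exact_mod_cast h3
    have h4 : -2 < (wordIndex n w k : ℤ) - wordIndex n w' k := by exact_mod_cast h4
    rw [abs_le]
    omega
  obtain ⟨i, j, hij⟩ := exists_shift_eq key
    (Nat.succ_injective ((sum_wordIndex n w).trans (sum_wordIndex n w').symm))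
  exact ⟨i, j, (wordMap_p_eq_iff n w w' i j).2 hij⟩

/-- Comparing the j-th coordinates forces that of x to be at least 1, which happens only at the
corner p_j; symmetrically for y. -/
theorem eq_p_of_f_eq_f {i j : Fin 3} (hij : i ≠ j) {x y : K} (h : f i x = f j y) :
    x = p j ∧ y = p i := by
  have hb : ∀ k, bary k x + (if k = i then 1 else 0) = bary k y + if k = j then 1 else 0 := by
    intro k
    have h1 : bary k (contr i x) = bary k (contr j y) := by
      have := congrArg (fun z : K => bary k z) h
      exact this
    rw [bary_contr, bary_contr] at h1
    linarith
  have corner_of : ∀ (z : K) (k : Fin 3), 1 ≤ bary k z → z = p k := by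
    intro z k hk
    refine Subtype.ext (bary_injective fun m => ?_)
    change _ = bary m (corner k)
    rw [bary_corner]
    have hs := sum_bary z
    have h0 := bary_nonneg 0 z.2
    have h1 := bary_nonneg 1 z.2
    have h2 := bary_nonneg 2 z.2
    rw [Fin.sum_univ_three] at hs
    fin_cases k <;> fin_cases m <;> simp at hk ⊢ <;> linarith
  constructor
  · apply corner_of
    have := hb j
    rw [if_neg hij.symm, if_pos rfl] at this
    linarith [bary_nonneg j y.2]
  · apply corner_of
    have := hb i
    rw [if_neg hij, if_pos rfl] at this
    linarith [bary_nonneg i x.2]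

end Gasket

namespace Gasket

/-! ### The Hausdorff measure of the gasket -/

theorem α_pos : 0 < α := div_pos (Real.log_pos (by norm_num)) (Real.log_pos (by norm_num))

theorem two_rpow_α : (2 : ℝ) ^ α = 3 := by
  rw [α, Real.rpow_def_of_pos (by norm_num), mul_div_cancel₀ _ (Real.log_pos (by norm_num)).ne',
    Real.exp_log (by norm_num)]

theorem half_pow_rpow_α (n : ℕ) : (((1 : ℝ) / 2) ^ n) ^ α = (1 / 3) ^ n := by
  rw [← Real.rpow_natCast, ← Real.rpow_mul (by norm_num), mul_comm, Real.rpow_mul (by norm_num),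
    one_div, Real.inv_rpow (by norm_num), two_rpow_α, Real.rpow_natCast, one_div]

theorem ofReal_half_pow_rpow_α (n : ℕ) :
    ENNReal.ofReal (((1 : ℝ) / 2) ^ n) ^ α = (3⁻¹ : ℝ≥0∞) ^ n := by
  rw [ENNReal.ofReal_rpow_of_pos (by positivity), half_pow_rpow_α,
    ENNReal.ofReal_pow (by norm_num), one_div, ENNReal.ofReal_inv_of_pos (by norm_num)]
  norm_num

theorem ediam_range_wordMap_le (n : ℕ) (w : Fin n → Fin 3) :
    Metric.ediam (Set.range (wordMap n w)) ≤ ENNReal.ofReal ((1 / 2) ^ n) := by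
  refine Metric.ediam_le ?_
  rintro _ ⟨x, rfl⟩ _ ⟨y, rfl⟩
  rw [edist_dist, dist_wordMap]
  refine ENNReal.ofReal_le_ofReal ?_
  rw [one_div, inv_pow, div_eq_mul_inv]
  exact mul_le_of_le_one_left (by positivity) (dist_le_one x y)

/-- Covering by the 3ⁿ cells of level n, each of diameter at most 2⁻ⁿ, gives the sum 3ⁿ · 3⁻ⁿ = 1.
-/
theorem hausdorffMeasure_univ_le : (Measure.hausdorffMeasure α : Measure K) Set.univ ≤ 1 := by
  refine (Measure.hausdorffMeasure_le_liminf_sum (ι := fun n : ℕ => Fin n → Fin 3) α Set.univ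
    (l := atTop) (fun n : ℕ => ENNReal.ofReal ((1 / 2) ^ n)) ?_
    (fun n w => Set.range (wordMap n w))
    (Eventually.of_forall fun n w => ediam_range_wordMap_le n w)
    (Eventually.of_forall fun n x _ => ?_)).trans ?_
  · rw [← ENNReal.ofReal_zero]
    exact ENNReal.tendsto_ofReal
      (tendsto_pow_atTop_nhds_zero_of_lt_one (by norm_num) (by norm_num))
  · obtain ⟨w, y, rfl⟩ := exists_wordMap_eq n x
    exact Set.mem_iUnion.2 ⟨w, y, rfl⟩
  · refine liminf_le_of_le (by isBoundedDefault) fun b hb => ?_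
    obtain ⟨n, hn⟩ := hb.exists
    refine hn.trans ((Finset.sum_le_sum fun w _ =>
      ENNReal.rpow_le_rpow (ediam_range_wordMap_le n w) α_pos.le).trans ?_)
    simp only [ofReal_half_pow_rpow_α, Finset.sum_const, Finset.card_univ, Fintype.card_pi,
      Fintype.card_fin, Finset.prod_const, nsmul_eq_mul, Nat.cast_pow]
    rw [← mul_pow]
    norm_num [ENNReal.mul_inv_cancel]

/-- The point `f_{ω₀ ⋯ ω_{n-1}}(p₀)`. -/
noncomputable def codePoint (n : ℕ) (ω : ℕ → Fin 3) : K := wordMap n (fun i => ω i) (p 0)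

theorem codePoint_succ (n : ℕ) (ω : ℕ → Fin 3) :
    codePoint (n + 1) ω = f (ω 0) (codePoint n fun k => ω (k + 1)) := by
  simp only [codePoint, wordMap, Function.comp_apply, Fin.val_zero]
  rfl

theorem dist_codePoint_succ (n : ℕ) (ω : ℕ → Fin 3) :
    dist (codePoint n ω) (codePoint (n + 1) ω) ≤ 1 / 2 ^ n := by
  induction n generalizing ω with
  | zero => simpa using dist_le_one _ _
  | succ n ih =>
    rw [codePoint_succ, codePoint_succ (n + 1), dist_f, pow_succ, ← div_div]
    exact div_le_div_of_nonneg_right (ih _) (by norm_num)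

theorem exists_tendsto_codePoint (ω : ℕ → Fin 3) :
    ∃ x, Tendsto (fun n => codePoint n ω) atTop (𝓝 x) := by
  refine cauchySeq_tendsto_of_complete (cauchySeq_of_le_geometric (1 / 2) 1 (by norm_num) ?_)
  intro n
  simpa using dist_codePoint_succ n ω

/-- The point of the gasket with a given address. -/
noncomputable def address (ω : ℕ → Fin 3) : K := (exists_tendsto_codePoint ω).choose

theorem tendsto_codePoint (ω : ℕ → Fin 3) :
    Tendsto (fun n => codePoint n ω) atTop (𝓝 (address ω)) :=
  (exists_tendsto_codePoint ω).choose_spec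

theorem measurable_address : Measurable address := by
  refine measurable_of_tendsto_metrizable (f := codePoint) (fun n => ?_)
    (tendsto_pi_nhds.2 tendsto_codePoint)
  have h : Measurable fun w : Fin n → Fin 3 => wordMap n w (p 0) := measurable_of_finite _
  exact h.comp (measurable_pi_lambda _ fun i => measurable_pi_apply _)

theorem address_eq (n : ℕ) (ω : ℕ → Fin 3) :
    address ω = wordMap n (fun i => ω i) (address fun k => ω (k + n)) := by
  induction n generalizing ω with
  | zero => rfl
  | succ n ih =>
    have h : address ω = f (ω 0) (address fun k => ω (k + 1)) := by
      refine tendsto_nhds_unique ((tendsto_add_atTop_iff_nat 1).2 (tendsto_codePoint ω)) ?_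
      simp only [codePoint_succ]
      exact ((continuous_f _).tendsto _).comp (tendsto_codePoint _)
    rw [h, ih]
    rfl

/-- The uniform Bernoulli measure on addresses. -/
noncomputable def bernoulli : Measure (ℕ → Fin 3) :=
  Measure.infinitePi fun _ => (PMF.uniformOfFintype (Fin 3)).toMeasure

instance : IsProbabilityMeasure bernoulli := by unfold bernoulli; infer_instance

theorem bernoulli_cylinder (n : ℕ) (w : Fin n → Fin 3) :
    bernoulli {ω | (fun i : Fin n => ω i) = w} = 3⁻¹ ^ n := by
  have h : {ω : ℕ → Fin 3 | (fun i : Fin n => ω i) = w} =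
      Set.pi (Finset.range n) fun i => if h : i < n then {w ⟨i, h⟩} else Set.univ := by
    ext ω
    simp only [Set.mem_ofPred_eq, funext_iff, Set.mem_pi, Finset.coe_range, Set.mem_Iio]
    constructor
    · intro h i hi
      rw [dif_pos hi]
      exact h ⟨i, hi⟩
    · intro h i
      have := h i i.2
      rw [dif_pos i.2] at this
      exact this
  rw [h, bernoulli, Measure.infinitePi_pi _ fun i _ => MeasurableSet.of_discrete,
    Finset.prod_range]
  simp

/-- The ball meets only the level-n cells adjacent to one containing its centre, at most nine in
number, each cylinder having mass 3⁻ⁿ. -/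
theorem bernoulli_closedBall_le (n : ℕ) (x : K) :
    bernoulli.map address (Metric.closedBall x ((1 / 2) ^ (n + 1))) ≤ 9 * 3⁻¹ ^ n := by
  classical
  rw [Measure.map_apply measurable_address Metric.isClosed_closedBall.measurableSet]
  obtain ⟨w, z, rfl⟩ := exists_wordMap_eq n x
  have h : address ⁻¹' Metric.closedBall (wordMap n w z) ((1 / 2) ^ (n + 1)) ⊆
      ⋃ w' ∈ Finset.univ.filter fun w' => Adj n w w', {ω | (fun i : Fin n => ω i) = w'} := by
    intro ω hω
    rw [Set.mem_preimage, Metric.mem_closedBall, address_eq n ω] at hω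
    simp only [Set.mem_iUnion]
    exact ⟨_, by simpa using (adj_of_dist_le hω).symm, rfl⟩
  refine (measure_mono h).trans ((measure_biUnion_finset_le _ _).trans ?_)
  simp only [bernoulli_cylinder, Finset.sum_const, nsmul_eq_mul]
  gcongr
  exact_mod_cast card_adj_le n w

/-- Mass distribution principle: small sets s have Bernoulli mass at most 81 · (diam s)^α. -/
theorem bernoulli_le_hausdorffMeasure :
    (81⁻¹ : ℝ≥0∞) • bernoulli.map address ≤ Measure.hausdorffMeasure α := by
  refine Measure.le_hausdorffMeasure α _ (ENNReal.ofReal (1 / 2)) (by simp) fun s hs => ?_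
  rw [Measure.smul_apply, smul_eq_mul, mul_comm, ← div_eq_mul_inv]
  refine ENNReal.div_le_of_le_mul' ?_
  rcases s.eq_empty_or_nonempty with rfl | ⟨x, hx⟩
  · simp
  have key : ∀ n : ℕ, Metric.ediam s ≤ ENNReal.ofReal ((1 / 2) ^ (n + 1)) →
      bernoulli.map address s ≤ 9 * 3⁻¹ ^ n := by
    intro n hn
    refine (measure_mono fun y hy => ?_).trans (bernoulli_closedBall_le n x)
    have := (Metric.edist_le_ediam_of_mem hy hx).trans hn
    rw [edist_dist] at this
    exact (ENNReal.ofReal_le_ofReal_iff (by positivity)).1 this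
  -- A set below every dyadic scale has mass zero. Otherwise m is chosen with 2^(-m-1) < diam s ≤
  -- 2^(-m).
  by_cases hall : ∀ n : ℕ, Metric.ediam s ≤ ENNReal.ofReal ((1 / 2) ^ (n + 1))
  · have h0 : Tendsto (fun n : ℕ => (9 : ℝ≥0∞) * 3⁻¹ ^ n) atTop (𝓝 0) := by
      have := ENNReal.Tendsto.const_mul (a := 9) (ENNReal.tendsto_pow_atTop_nhds_zero_of_lt_one
        (r := 3⁻¹) (by simp [ENNReal.inv_lt_one])) (Or.inr (by simp))
      simpa using this
    have := ge_of_tendsto' h0 fun n => key n (hall n)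
    rw [nonpos_iff_eq_zero] at this
    rw [this]
    exact zero_le
  · push Not at hall
    obtain ⟨m, hspec, hmin⟩ : ∃ m : ℕ, ENNReal.ofReal ((1 / 2) ^ (m + 1)) < Metric.ediam s ∧
        ∀ k < m, ¬ ENNReal.ofReal ((1 / 2) ^ (k + 1)) < Metric.ediam s :=
      ⟨Nat.find hall, Nat.find_spec hall, fun k => Nat.find_min hall⟩
    -- The case m = 0 is excluded by the restriction to sets of diameter at most 1/2.
    obtain _ | n := m
    · simp only [zero_add, pow_one] at hspec
      exact absurd hs hspec.not_ge
    refine (key n (not_lt.1 (hmin n (Nat.lt_succ_self n)))).trans ?_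
    have h1 := ENNReal.rpow_le_rpow hspec.le α_pos.le
    rw [ofReal_half_pow_rpow_α] at h1
    -- With m = n + 1 the lower bound on the diameter is at scale n + 2, two levels below the mass
    -- bound: 9 · 3⁻ⁿ = 9 · 3² · 3^(-n-2).
    refine le_trans (le_of_eq ?_) (mul_le_mul_right h1 81)
    rw [pow_add, pow_add, show (81 : ℝ≥0∞) = 9 * (3 * 3) by norm_num]
    have : (3 : ℝ≥0∞) * 3⁻¹ = 1 := ENNReal.mul_inv_cancel (by simp) (by simp)
    calc 9 * (3⁻¹ : ℝ≥0∞) ^ n = 9 * 3⁻¹ ^ n * (3 * 3⁻¹) * (3 * 3⁻¹) := by rw [this]; simp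
      _ = _ := by ring

theorem hausdorffMeasure_univ_ne_zero :
    (Measure.hausdorffMeasure α : Measure K) Set.univ ≠ 0 := by
  have h := bernoulli_le_hausdorffMeasure Set.univ
  rw [Measure.smul_apply, Measure.map_apply measurable_address MeasurableSet.univ] at h
  simp only [Set.preimage_univ, measure_univ, smul_eq_mul, mul_one] at h
  intro h0
  rw [h0] at h
  simp at h

theorem hausdorffMeasure_univ_ne_top :
    (Measure.hausdorffMeasure α : Measure K) Set.univ ≠ ⊤ :=
  ne_top_of_le_ne_top ENNReal.one_ne_top hausdorffMeasure_univ_le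

instance : IsProbabilityMeasure ν where
  measure_univ := by
    rw [ν, Measure.smul_apply, smul_eq_mul]
    exact ENNReal.inv_mul_cancel hausdorffMeasure_univ_ne_zero hausdorffMeasure_univ_ne_top

/-! ### Self-similarity and full support of ν -/

theorem measurableEmbedding_f (i : Fin 3) : MeasurableEmbedding (f i) :=
  ((continuous_f i).isClosedEmbedding (f_injective i)).measurableEmbedding

theorem hausdorffMeasure_image_f (i : Fin 3) (s : Set K) :
    Measure.hausdorffMeasure α (f i '' s) = 3⁻¹ * Measure.hausdorffMeasure α s := by
  have h1 : LipschitzWith 2⁻¹ (f i) := LipschitzWith.of_dist_le_mul fun x y => by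
    rw [dist_f]; push_cast; linarith
  have h2 : AntilipschitzWith 2 (f i) := AntilipschitzWith.of_le_mul_dist fun x y => by
    rw [dist_f]; push_cast; linarith
  have e2 : ((2 : ℝ≥0) : ℝ≥0∞) ^ α = 3 := by
    rw [← ENNReal.ofReal_coe_nnreal, ENNReal.ofReal_rpow_of_pos (by norm_num)]
    push_cast
    rw [two_rpow_α]
    norm_num
  have e1 : ((2⁻¹ : ℝ≥0) : ℝ≥0∞) ^ α = 3⁻¹ := by
    rw [ENNReal.coe_inv (by norm_num), ENNReal.inv_rpow, e2]
  refine le_antisymm ?_ ?_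
  · have := h1.hausdorffMeasure_image_le α_pos.le s
    rwa [e1] at this
  · have := h2.le_hausdorffMeasure_image α_pos.le s
    rw [e2] at this
    rw [mul_comm, ← div_eq_mul_inv]
    exact ENNReal.div_le_of_le_mul' this

/-- Distinct cells meet in at most one point, and points are null because α > 0. -/
theorem hausdorffMeasure_eq_sum :
    (Measure.hausdorffMeasure α : Measure K) =
      (3⁻¹ : ℝ≥0∞) • ∑ i, (Measure.hausdorffMeasure α : Measure K).map (f i) := by
  ext s hs
  have := Measure.nullSingletonClass_hausdorff K α_pos
  have hU : s = ⋃ i, f i '' (f i ⁻¹' s) := by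
    ext x
    simp only [Set.mem_iUnion]
    constructor
    · intro hx
      obtain ⟨i, y, rfl⟩ := exists_f_eq x
      exact ⟨i, y, hx, rfl⟩
    · rintro ⟨i, y, hy, rfl⟩
      exact hy
  have hm : ∀ i, MeasurableSet (f i '' (f i ⁻¹' s)) := fun i =>
    (measurableEmbedding_f i).measurableSet_image.2 ((continuous_f i).measurable hs)
  conv_lhs => rw [hU]
  rw [measure_iUnion₀ ?_ fun i => (hm i).nullMeasurableSet]
  · simp only [hausdorffMeasure_image_f, tsum_fintype]
    rw [Measure.smul_apply, Measure.finsetSum_apply, smul_eq_mul, Finset.mul_sum]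
    exact Finset.sum_congr rfl fun i _ => by rw [Measure.map_apply (continuous_f i).measurable hs]
  · intro i j hij
    refine measure_mono_null (t := {f i (p j)}) ?_ (measure_singleton _)
    rintro _ ⟨⟨x, -, rfl⟩, ⟨y, -, h⟩⟩
    rw [Set.mem_singleton_iff, (eq_p_of_f_eq_f hij h.symm).1]

theorem ν_eq_sum : ν = (3⁻¹ : ℝ≥0∞) • ∑ i, ν.map (f i) := by
  unfold ν
  simp only [Measure.map_smul]
  rw [← Finset.smul_sum, smul_comm, ← hausdorffMeasure_eq_sum]

theorem lintegral_eq_sum_f (g : K → ℝ≥0∞) :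
    ∫⁻ x, g x ∂ν = 3⁻¹ * ∑ i, ∫⁻ x, g (f i x) ∂ν := by
  conv_lhs => rw [ν_eq_sum]
  rw [lintegral_smul_measure, lintegral_finsetSum_measure, smul_eq_mul]
  simp only [(measurableEmbedding_f _).lintegral_map]

theorem lintegral_eq_sum_word (n : ℕ) (g : K → ℝ≥0∞) :
    ∫⁻ x, g x ∂ν = 3⁻¹ ^ n * ∑ w : Fin n → Fin 3, ∫⁻ x, g (wordMap n w x) ∂ν := by
  induction n generalizing g with
  | zero => simp [wordMap]
  | succ n ih =>
    rw [lintegral_eq_sum_f, sum_word_succ n fun h => ∫⁻ x, g (h x) ∂ν, pow_succ', mul_assoc]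
    congr 1
    rw [Finset.mul_sum]
    exact Finset.sum_congr rfl fun i _ => ih fun x => g (f i x)

instance : Measure.IsOpenPosMeasure ν where
  open_pos U hU hne := by
    obtain ⟨x, hx⟩ := hne
    obtain ⟨r, hr, hball⟩ := Metric.isOpen_iff.1 hU x hx
    obtain ⟨n, hn⟩ := exists_pow_lt_of_lt_one hr (by norm_num : (1 / 2 : ℝ) < 1)
    obtain ⟨w, z, rfl⟩ := exists_wordMap_eq n x
    have hmem : ∀ y, wordMap n w y ∈ U := fun y => hball <| by
      rw [Metric.mem_ball, dist_wordMap]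
      refine lt_of_le_of_lt ?_ hn
      rw [one_div, inv_pow, div_eq_mul_inv]
      exact mul_le_of_le_one_left (by positivity) (dist_le_one _ _)
    rw [← lintegral_indicator_one hU.measurableSet, lintegral_eq_sum_word n]
    refine mul_ne_zero (pow_ne_zero _ (by simp)) fun h0 => ?_
    have := Finset.sum_eq_zero_iff.1 h0 w (Finset.mem_univ _)
    simp [hmem] at this

end Gasket

namespace Gasket

/-! ### Comparison of the discrete and the stable-like energies -/

theorem sum_cellSum_comp_wordMap (m n : ℕ) (u : K → ℝ) :
    ∑ w : Fin m → Fin 3, cellSum n (u ∘ wordMap m w) = cellSum (m + n) u := by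
  induction m generalizing u with
  | zero => simp [wordMap]
  | succ m ih =>
    rw [sum_word_succ m fun h => cellSum n (u ∘ h), Nat.succ_add, cellSum_succ]
    exact Finset.sum_congr rfl fun k _ => ih (u ∘ f k)

theorem cellSum_nonneg (n : ℕ) (u : K → ℝ) : 0 ≤ cellSum n u := by
  unfold cellSum
  positivity

/-- The ratio `2^{β - α}` of consecutive weights in `E_β`. -/
noncomputable def ratio (β : ℝ) : ℝ≥0 := ⟨2 ^ (β - α), by positivity⟩

theorem coe_ratio (β : ℝ) : (ratio β : ℝ) = 2 ^ (β - α) := rfl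

theorem one_lt_ratio {β : ℝ} (h : α < β) : 1 < ratio β := by
  rw [← NNReal.coe_lt_coe]
  exact Real.one_lt_rpow (by norm_num) (by linarith)

theorem discreteEnergy_eq (β : ℝ) (u : K → ℝ) :
    discreteEnergy β u =
      ∑' n : ℕ, (ratio β : ℝ≥0∞) ^ (n + 1) * ENNReal.ofReal (cellSum (n + 1) u) := by
  refine tsum_congr fun n => ?_
  rw [Real.rpow_mul (by norm_num), Real.rpow_natCast, ENNReal.ofReal_mul (by positivity),
    ← coe_ratio, ENNReal.ofReal_pow (by positivity), ENNReal.ofReal_coe_nnreal]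

theorem two_rpow_add (β : ℝ) : (2 : ℝ) ^ (α + β) = 9 * ratio β := by
  rw [coe_ratio, show α + β = α + α + (β - α) by ring, Real.rpow_add (by norm_num),
    Real.rpow_add (by norm_num), two_rpow_α]
  norm_num

theorem half_pow_rpow_add (β : ℝ) (n : ℕ) :
    (((1 : ℝ) / 2) ^ n) ^ (α + β) = ((9 * (ratio β : ℝ)) ^ n)⁻¹ := by
  rw [← Real.rpow_natCast, ← Real.rpow_mul (by norm_num), mul_comm, Real.rpow_mul (by norm_num),
    one_div, Real.inv_rpow (by norm_num), two_rpow_add, Real.rpow_natCast, inv_pow]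

/-- The increment `(u(x) - u(y))²`. -/
noncomputable def incr (u : K → ℝ) (x y : K) : ℝ≥0∞ := ENNReal.ofReal ((u x - u y) ^ 2)

/-- The increment `(u(x) - u(y))²`, cut off at distance `2⁻ⁿ`. -/
noncomputable def nearIncr (n : ℕ) (u : K → ℝ) (x y : K) : ℝ≥0∞ :=
  if dist x y ≤ (1 / 2) ^ n then incr u x y else 0

/-- `∫∫_{|x - y| ≤ 2⁻ⁿ} (u(x) - u(y))² ν(dx) ν(dy)`. -/
noncomputable def nearEnergy (n : ℕ) (u : K → ℝ) : ℝ≥0∞ := ∫⁻ y, ∫⁻ x, nearIncr n u x y ∂ν ∂ν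

theorem incr_le (u : K → ℝ) (x y z : K) : incr u x y ≤ 2 * incr u x z + 2 * incr u y z := by
  have h2 : (2 : ℝ≥0∞) = ENNReal.ofReal 2 := by simp
  unfold incr
  rw [h2, ← ENNReal.ofReal_mul (by norm_num), ← ENNReal.ofReal_mul (by norm_num),
    ← ENNReal.ofReal_add (by positivity) (by positivity)]
  exact ENNReal.ofReal_le_ofReal (by nlinarith [sq_nonneg (u x - u z + (u y - u z))])

theorem measurable_incr {u : K → ℝ} (hu : Continuous u) (y : K) :
    Measurable fun x => incr u x y :=
  ENNReal.measurable_ofReal.comp (by fun_prop : Continuous fun x => (u x - u y) ^ 2).measurable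

theorem measurable_nearIncr (n : ℕ) {u : K → ℝ} (hu : Continuous u) :
    Measurable fun q : K × K => nearIncr n u q.1 q.2 := by
  refine Measurable.ite ?_ (ENNReal.measurable_ofReal.comp
    (by fun_prop : Continuous fun q : K × K => (u q.1 - u q.2) ^ 2).measurable) measurable_const
  exact (isClosed_le continuous_dist continuous_const).measurableSet

theorem exists_scale {x y : K} (h : x ≠ y) :
    ∃ n : ℕ, (1 / 2 : ℝ) ^ (n + 1) < dist x y ∧ dist x y ≤ (1 / 2) ^ n := by
  exact exists_nat_pow_near_of_lt_one (dist_pos.2 h) (dist_le_one x y) (by norm_num) (by norm_num)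

/-- The single term of the dyadic shell 2^(-n-1) < |x - y| ≤ 2⁻ⁿ suffices, since there |x -
y|^-(α+β) ≤ (9t)^(n+1) with t = `ratio β`. -/
theorem stable_kernel_le {β : ℝ} (hβ : α < β) (u : K → ℝ) (x y : K) :
    ENNReal.ofReal ((u x - u y) ^ 2 / dist x y ^ (α + β)) ≤
      ∑' n : ℕ, (9 * (ratio β : ℝ≥0∞)) ^ (n + 1) * nearIncr n u x y := by
  rcases eq_or_ne x y with rfl | hxy
  · simp
  obtain ⟨n, h1, h2⟩ := exists_scale hxy
  refine le_trans ?_ (ENNReal.le_tsum n)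
  have hpos : 0 < dist x y ^ (α + β) := Real.rpow_pos_of_pos (dist_pos.2 hxy) _
  have h3 : ((9 * (ratio β : ℝ)) ^ (n + 1))⁻¹ ≤ dist x y ^ (α + β) := by
    rw [← half_pow_rpow_add]
    exact Real.rpow_le_rpow (by positivity) h1.le (by linarith [α_pos])
  have hr : 0 < (9 * (ratio β : ℝ)) ^ (n + 1) := by
    have : (0 : ℝ) < ratio β := zero_lt_one.trans (one_lt_ratio hβ)
    positivity
  rw [nearIncr, if_pos h2, incr]
  have e : (9 * (ratio β : ℝ≥0∞)) ^ (n + 1) = ENNReal.ofReal ((9 * (ratio β : ℝ)) ^ (n + 1)) := by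
    rw [ENNReal.ofReal_pow (by positivity), ENNReal.ofReal_mul (by norm_num),
      ENNReal.ofReal_coe_nnreal]
    norm_num
  rw [e, ← ENNReal.ofReal_mul hr.le]
  refine ENNReal.ofReal_le_ofReal ?_
  rw [div_eq_mul_inv, mul_comm]
  refine mul_le_mul_of_nonneg_right ?_ (sq_nonneg _)
  exact inv_le_of_inv_le₀ hr h3

/-- Only scales down to |x - y| contribute, and a geometric sum with ratio at least 2 is at most
twice its last term. -/
theorem le_stable_kernel {β : ℝ} (hβ : α < β) (u : K → ℝ) (x y : K) :
    ∑' n : ℕ, (9 * (ratio β : ℝ≥0∞)) ^ n * nearIncr n u x y ≤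
      2 * ENNReal.ofReal ((u x - u y) ^ 2 / dist x y ^ (α + β)) := by
  rcases eq_or_ne x y with rfl | hxy
  · simp [nearIncr, incr]
  obtain ⟨N, h1, h2⟩ := exists_scale hxy
  have hone : (1 : ℝ) < ratio β := one_lt_ratio hβ
  have hgeom : ∀ N : ℕ, ∑ n ∈ Finset.range (N + 1), (9 * (ratio β : ℝ)) ^ n ≤
      2 * (9 * (ratio β : ℝ)) ^ N := by
    intro N
    induction N with
    | zero => simp
    | succ N ih =>
      rw [Finset.sum_range_succ, pow_succ]
      have : 0 < (9 * (ratio β : ℝ)) ^ N := by positivity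
      nlinarith
  have hzero : ∀ n ∉ Finset.range (N + 1),
      (9 * (ratio β : ℝ≥0∞)) ^ n * nearIncr n u x y = 0 := by
    intro n hn
    rw [nearIncr, if_neg, mul_zero]
    rw [Finset.mem_range, not_lt] at hn
    refine not_le.2 (lt_of_le_of_lt ?_ h1)
    exact pow_le_pow_of_le_one (by norm_num) (by norm_num) hn
  rw [tsum_eq_sum hzero]
  have hpos : 0 < dist x y ^ (α + β) := Real.rpow_pos_of_pos (dist_pos.2 hxy) _
  calc ∑ n ∈ Finset.range (N + 1), (9 * (ratio β : ℝ≥0∞)) ^ n * nearIncr n u x y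
      ≤ ∑ n ∈ Finset.range (N + 1),
        ENNReal.ofReal ((9 * (ratio β : ℝ)) ^ n) * incr u x y := by
        refine Finset.sum_le_sum fun n _ => ?_
        have e : (9 * (ratio β : ℝ≥0∞)) ^ n = ENNReal.ofReal ((9 * (ratio β : ℝ)) ^ n) := by
          rw [ENNReal.ofReal_pow (by positivity), ENNReal.ofReal_mul (by norm_num),
            ENNReal.ofReal_coe_nnreal]
          norm_num
        rw [e, nearIncr]
        gcongr
        split_ifs
        · exact le_rfl
        · exact zero_le
    _ = ENNReal.ofReal ((∑ n ∈ Finset.range (N + 1), (9 * (ratio β : ℝ)) ^ n) *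
          (u x - u y) ^ 2) := by
        rw [← Finset.sum_mul, ← ENNReal.ofReal_sum_of_nonneg fun n _ => by positivity, incr,
          ENNReal.ofReal_mul (by positivity)]
    _ ≤ ENNReal.ofReal (2 * ((u x - u y) ^ 2 / dist x y ^ (α + β))) := by
        refine ENNReal.ofReal_le_ofReal ?_
        have h3 : dist x y ^ (α + β) ≤ ((9 * (ratio β : ℝ)) ^ N)⁻¹ := by
          rw [← half_pow_rpow_add]
          exact Real.rpow_le_rpow dist_nonneg h2 (by linarith [α_pos])
        have h4 := le_inv_of_le_inv₀ hpos h3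
        calc _ ≤ 2 * (9 * (ratio β : ℝ)) ^ N * (u x - u y) ^ 2 :=
              mul_le_mul_of_nonneg_right (hgeom N) (sq_nonneg _)
          _ ≤ 2 * (dist x y ^ (α + β))⁻¹ * (u x - u y) ^ 2 := by gcongr
          _ = _ := by ring
    _ = _ := by
        rw [ENNReal.ofReal_mul (by norm_num)]
        simp

theorem measurable_nearIncr_left (n : ℕ) {u : K → ℝ} (hu : Continuous u) (y : K) :
    Measurable fun x => nearIncr n u x y := by
  refine Measurable.ite ?_ (measurable_incr hu y) measurable_const
  exact (isClosed_le (continuous_id.dist continuous_const) continuous_const).measurableSet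

theorem measurable_lintegral_nearIncr (n : ℕ) {u : K → ℝ} (hu : Continuous u) :
    Measurable fun y => ∫⁻ x, nearIncr n u x y ∂ν :=
  Measurable.lintegral_prod_left' (f := fun q : K × K => nearIncr n u q.1 q.2)
    (measurable_nearIncr n hu)

theorem lintegral_tsum_nearIncr {u : K → ℝ} (hu : Continuous u) (c : ℕ → ℝ≥0∞) :
    ∫⁻ y, ∫⁻ x, ∑' n, c n * nearIncr n u x y ∂ν ∂ν = ∑' n, c n * nearEnergy n u := by
  have h2 : ∀ y, ∫⁻ x, ∑' n, c n * nearIncr n u x y ∂ν =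
      ∑' n, c n * ∫⁻ x, nearIncr n u x y ∂ν := fun y => by
    rw [lintegral_tsum fun n => ((measurable_nearIncr_left n hu y).const_mul _).aemeasurable]
    exact tsum_congr fun n => lintegral_const_mul _ (measurable_nearIncr_left n hu y)
  simp only [h2]
  rw [lintegral_tsum fun n => ((measurable_lintegral_nearIncr n hu).const_mul _).aemeasurable]
  exact tsum_congr fun n => lintegral_const_mul _ (measurable_lintegral_nearIncr n hu)

theorem stableEnergy_le_tsum {β : ℝ} (hβ : α < β) {u : K → ℝ} (hu : Continuous u) :
    stableEnergy β u ≤ ∑' n : ℕ, (9 * (ratio β : ℝ≥0∞)) ^ (n + 1) * nearEnergy n u := by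
  rw [← lintegral_tsum_nearIncr hu]
  exact lintegral_mono fun y => lintegral_mono fun x => stable_kernel_le hβ u x y

theorem tsum_le_stableEnergy {β : ℝ} (hβ : α < β) {u : K → ℝ} (hu : Continuous u) :
    ∑' n : ℕ, (9 * (ratio β : ℝ≥0∞)) ^ n * nearEnergy n u ≤ 2 * stableEnergy β u := by
  rw [← lintegral_tsum_nearIncr hu, stableEnergy, ← lintegral_const_mul' _ _ (by simp)]
  refine lintegral_mono fun y => ?_
  rw [← lintegral_const_mul' _ _ (by simp)]
  exact lintegral_mono fun x => le_stable_kernel hβ u x y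

/-! #### The stable-like energy is dominated by the discrete energy -/

/-- Riemann sums over cells, sampled at the i-th corner; uniform continuity controls the error. -/
theorem lintegral_le_sum_wordMap {h : K → ℝ} (hc : Continuous h) (i : Fin 3) {ε : ℝ}
    (hε : 0 < ε) :
    ∃ N : ℕ, ∫⁻ x, ENNReal.ofReal (h x) ∂ν ≤
      3⁻¹ ^ N * ∑ w : Fin N → Fin 3, ENNReal.ofReal (h (wordMap N w (p i))) +
        ENNReal.ofReal ε := by
  obtain ⟨δ, hδ, hunif⟩ :=
    Metric.uniformContinuous_iff.1 (CompactSpace.uniformContinuous_of_continuous hc) ε hε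
  obtain ⟨N, hN⟩ := exists_pow_lt_of_lt_one hδ (by norm_num : (1 / 2 : ℝ) < 1)
  refine ⟨N, ?_⟩
  rw [lintegral_eq_sum_word N]
  have hw : ∀ w : Fin N → Fin 3, ∫⁻ x, ENNReal.ofReal (h (wordMap N w x)) ∂ν ≤
      ENNReal.ofReal (h (wordMap N w (p i))) + ENNReal.ofReal ε := by
    intro w
    calc ∫⁻ x, ENNReal.ofReal (h (wordMap N w x)) ∂ν
        ≤ ∫⁻ x, (ENNReal.ofReal (h (wordMap N w (p i))) + ENNReal.ofReal ε) ∂ν := by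
          refine lintegral_mono fun x => ?_
          refine le_trans (ENNReal.ofReal_le_ofReal ?_) ENNReal.ofReal_add_le
          have hd : dist (wordMap N w x) (wordMap N w (p i)) < δ := by
            refine lt_of_le_of_lt ?_ hN
            rw [dist_wordMap, one_div, inv_pow, div_eq_mul_inv]
            exact mul_le_of_le_one_left (by positivity) (dist_le_one _ _)
          have := hunif hd
          rw [Real.dist_eq, abs_lt] at this
          linarith
      _ = _ := by simp
  refine (mul_le_mul_right (Finset.sum_le_sum fun w _ => hw w) _).trans (le_of_eq ?_)
  rw [Finset.sum_add_distrib, mul_add]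
  congr 1
  simp only [Finset.sum_const, Finset.card_univ, Fintype.card_pi, Fintype.card_fin,
    Finset.prod_const, nsmul_eq_mul, Nat.cast_pow]
  rw [← mul_assoc, ← mul_pow]
  norm_num [ENNReal.inv_mul_cancel]

/-- Since f_k(p_i) = f_i(p_k), all the points involved are vertices of the one cell f_i(K). -/
theorem sum_sub_corner_le (u : K → ℝ) (i : Fin 3) :
    ∑ k, (u (f k (p i)) - u (p i)) ^ 2 ≤ cellSum 1 u := by
  rw [cellSum_succ]
  calc ∑ k, (u (f k (p i)) - u (p i)) ^ 2
      = ∑ k, ((u ∘ f i) (p k) - (u ∘ f i) (p i)) ^ 2 := by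
        refine Finset.sum_congr rfl fun k _ => ?_
        simp only [Function.comp_apply, f_p_self]
        rw [f_p_comm]
    _ ≤ ∑ k, ∑ j, ((u ∘ f i) (p k) - (u ∘ f i) (p j)) ^ 2 :=
        Finset.sum_le_sum fun k _ => Finset.single_le_sum
          (f := fun j => ((u ∘ f i) (p k) - (u ∘ f i) (p j)) ^ 2) (fun j _ => sq_nonneg _)
          (Finset.mem_univ i)
    _ = cellSum 0 (u ∘ f i) := by simp [cellSum, wordMap]
    _ ≤ _ := Finset.single_le_sum (f := fun k => cellSum 0 (u ∘ f k))
        (fun k _ => cellSum_nonneg _ _) (Finset.mem_univ i)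

/-- Telescoping through f_k(p_i), k the first letter. Each level costs 2 from (a+b)² ≤ 2a² + 2b² and
gains 1/3 from the average over words, whence the ratio 2/3. -/
theorem sum_wordMap_sub_corner_le (N : ℕ) (u : K → ℝ) (i : Fin 3) :
    (1 / 3) ^ N * ∑ w : Fin N → Fin 3, (u (wordMap N w (p i)) - u (p i)) ^ 2 ≤
      2 * ∑ m ∈ Finset.range N, (2 / 3) ^ m * cellSum (m + 1) u := by
  induction N generalizing u with
  | zero => simp [wordMap]
  | succ N ih =>
    rw [sum_word_succ N fun h => (u (h (p i)) - u (p i)) ^ 2]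
    have h1 : ∑ k, ∑ w : Fin N → Fin 3, (u ((f k ∘ wordMap N w) (p i)) - u (p i)) ^ 2 ≤
        ∑ k, (2 * ∑ w : Fin N → Fin 3, ((u ∘ f k) (wordMap N w (p i)) - (u ∘ f k) (p i)) ^ 2 +
          2 * 3 ^ N * (u (f k (p i)) - u (p i)) ^ 2) := by
      refine Finset.sum_le_sum fun k _ => ?_
      have : 2 * 3 ^ N * (u (f k (p i)) - u (p i)) ^ 2 =
          ∑ w : Fin N → Fin 3, 2 * (u (f k (p i)) - u (p i)) ^ 2 := by
        simp
        ring
      rw [this, Finset.mul_sum, ← Finset.sum_add_distrib]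
      refine Finset.sum_le_sum fun w _ => ?_
      simp only [Function.comp_apply]
      nlinarith [sq_nonneg ((u (f k (wordMap N w (p i))) - u (f k (p i))) -
        (u (f k (p i)) - u (p i)))]
    rw [Finset.sum_add_distrib, ← Finset.mul_sum, ← Finset.mul_sum] at h1
    have h2 := Finset.sum_le_sum fun (k : Fin 3) (_ : k ∈ Finset.univ) => ih (u ∘ f k)
    rw [← Finset.mul_sum, ← Finset.mul_sum] at h2
    have h2' : ∑ k, ∑ m ∈ Finset.range N, (2 / 3 : ℝ) ^ m * cellSum (m + 1) (u ∘ f k) =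
        ∑ m ∈ Finset.range N, (2 / 3 : ℝ) ^ m * cellSum (m + 1 + 1) u := by
      rw [Finset.sum_comm]
      exact Finset.sum_congr rfl fun m _ => by rw [cellSum_succ (m + 1), Finset.mul_sum]
    rw [h2'] at h2
    rw [Finset.sum_range_succ']
    have h3 := sum_sub_corner_le u i
    have h4 := cellSum_nonneg 1 u
    have h5 : ∑ m ∈ Finset.range N, (2 / 3 : ℝ) ^ (m + 1) * cellSum (m + 1 + 1) u =
        2 / 3 * ∑ m ∈ Finset.range N, (2 / 3 : ℝ) ^ m * cellSum (m + 1 + 1) u := by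
      rw [Finset.mul_sum]
      exact Finset.sum_congr rfl fun m _ => by ring
    rw [h5]
    have h6 : (1 / 3 : ℝ) ^ N * 3 ^ N = 1 := by rw [← mul_pow]; norm_num
    calc _ ≤ (1 / 3 : ℝ) ^ (N + 1) * _ := mul_le_mul_of_nonneg_left h1 (by positivity)
      _ = 2 / 3 * ((1 / 3) ^ N * ∑ k, ∑ w : Fin N → Fin 3,
            ((u ∘ f k) (wordMap N w (p i)) - (u ∘ f k) (p i)) ^ 2) +
          2 / 3 * ((1 / 3 : ℝ) ^ N * 3 ^ N) * ∑ k, (u (f k (p i)) - u (p i)) ^ 2 := by ring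
      _ ≤ _ := by
        rw [h6]
        simp only [zero_add, pow_zero, one_mul, mul_one]
        linarith

/-- `∑ᵢ ∫ (u(x) - u(pᵢ))² ν(dx)`. -/
noncomputable def cornerEnergy (u : K → ℝ) : ℝ≥0∞ := ∑ i, ∫⁻ x, incr u x (p i) ∂ν

theorem lintegral_incr_corner_le {u : K → ℝ} (hu : Continuous u) (i : Fin 3) :
    ∫⁻ x, incr u x (p i) ∂ν ≤
      2 * ∑' m : ℕ, (2 / 3) ^ m * ENNReal.ofReal (cellSum (m + 1) u) := by
  refine ENNReal.le_of_forall_pos_le_add fun ε hε _ => ?_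
  obtain ⟨N, hN⟩ := lintegral_le_sum_wordMap (h := fun x => (u x - u (p i)) ^ 2) (by fun_prop) i
    (NNReal.coe_pos.2 hε)
  refine hN.trans ?_
  rw [ENNReal.ofReal_coe_nnreal]
  refine add_le_add ?_ le_rfl
  have e1 : (3⁻¹ : ℝ≥0∞) = ENNReal.ofReal (1 / 3) := by
    rw [one_div, ENNReal.ofReal_inv_of_pos (by norm_num)]; simp
  have e2 : (2 / 3 : ℝ≥0∞) = ENNReal.ofReal (2 / 3) := by
    rw [ENNReal.ofReal_div_of_pos (by norm_num)]; simp
  have e3 : (2 : ℝ≥0∞) = ENNReal.ofReal 2 := by simp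
  rw [e1, ← ENNReal.ofReal_pow (by norm_num), ← ENNReal.ofReal_sum_of_nonneg
    fun _ _ => sq_nonneg _, ← ENNReal.ofReal_mul (by positivity)]
  refine (ENNReal.ofReal_le_ofReal (sum_wordMap_sub_corner_le N u i)).trans ?_
  rw [ENNReal.ofReal_mul (by norm_num), ← e3]
  gcongr
  rw [ENNReal.ofReal_sum_of_nonneg fun m _ => mul_nonneg (by positivity) (cellSum_nonneg _ _)]
  refine le_trans (Finset.sum_le_sum fun m _ => ?_) (ENNReal.sum_le_tsum (Finset.range N))
  rw [ENNReal.ofReal_mul (by positivity), e2, ENNReal.ofReal_pow (by norm_num)]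

theorem sum_cornerEnergy_le (n : ℕ) {u : K → ℝ} (hu : Continuous u) :
    ∑ w : Fin n → Fin 3, cornerEnergy (u ∘ wordMap n w) ≤
      6 * ∑' m : ℕ, (2 / 3) ^ m * ENNReal.ofReal (cellSum (n + m + 1) u) := by
  calc ∑ w : Fin n → Fin 3, cornerEnergy (u ∘ wordMap n w)
      ≤ ∑ w : Fin n → Fin 3, ∑ _i : Fin 3,
        2 * ∑' m : ℕ, (2 / 3) ^ m * ENNReal.ofReal (cellSum (m + 1) (u ∘ wordMap n w)) :=
        Finset.sum_le_sum fun w _ => Finset.sum_le_sum fun i _ =>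
          lintegral_incr_corner_le (hu.comp (continuous_wordMap n w)) i
    _ = 6 * ∑ w : Fin n → Fin 3,
        ∑' m : ℕ, (2 / 3) ^ m * ENNReal.ofReal (cellSum (m + 1) (u ∘ wordMap n w)) := by
        simp only [Finset.sum_const, Finset.card_univ, Fintype.card_fin, nsmul_eq_mul]
        rw [Finset.mul_sum]
        refine Finset.sum_congr rfl fun w _ => ?_
        rw [← mul_assoc]
        norm_num
    _ = _ := by
        rw [← Summable.tsum_finsetSum fun _ _ => ENNReal.summable]
        congr 1
        refine tsum_congr fun m => ?_
        rw [← Finset.mul_sum, ← ENNReal.ofReal_sum_of_nonneg fun _ _ => cellSum_nonneg _ _,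
          sum_cellSum_comp_wordMap, add_assoc]

/-- Adjacent cells are compared through their shared vertex. Each of the two points pays a factor 2
and each cell has at most nine neighbours, so the constant is 2 · 2 · 9 = 36; 9⁻ⁿ is the product of
the masses of two cells. The general kernel φ covers both the truncated increments and the base
scale, where there is a single cell. -/
theorem lintegral_le_of_adj (n : ℕ) {u : K → ℝ} (hu : Continuous u) {φ : K → K → ℝ≥0∞}
    (hφ : ∀ x y, φ x y ≤ incr u x y)
    (hadj : ∀ w w' : Fin n → Fin 3, ¬ Adj n w' w → ∀ x y,
      φ (wordMap n w x) (wordMap n w' y) = 0) :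
    ∫⁻ y, ∫⁻ x, φ x y ∂ν ∂ν ≤
      36 * 9⁻¹ ^ n * ∑ w : Fin n → Fin 3, cornerEnergy (u ∘ wordMap n w) := by
  classical
  have hm : ∀ (w : Fin n → Fin 3) (j : Fin 3),
      Measurable fun x => incr (u ∘ wordMap n w) x (p j) := fun w j =>
    measurable_incr (hu.comp (continuous_wordMap n w)) _
  have hxy : ∀ w w' : Fin n → Fin 3, Adj n w' w → ∀ x y,
      φ (wordMap n w x) (wordMap n w' y) ≤ 2 * ∑ i, incr (u ∘ wordMap n w) x (p i) +
        2 * ∑ j, incr (u ∘ wordMap n w') y (p j) := by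
    intro w w' h x y
    obtain ⟨j, i, h⟩ := h
    refine (hφ _ _).trans ((incr_le u _ _ (wordMap n w (p i))).trans ?_)
    gcongr
    · exact Finset.single_le_sum (f := fun i => incr (u ∘ wordMap n w) x (p i))
        (fun _ _ => zero_le) (Finset.mem_univ i)
    · rw [← h]
      exact Finset.single_le_sum (f := fun i => incr (u ∘ wordMap n w') y (p i))
        (fun _ _ => zero_le) (Finset.mem_univ j)
  have hx : ∀ (w' : Fin n → Fin 3) (y : K), ∫⁻ x, φ x (wordMap n w' y) ∂ν ≤
      3⁻¹ ^ n * (∑ w ∈ Finset.univ.filter fun w => Adj n w' w,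
        2 * cornerEnergy (u ∘ wordMap n w) + 18 * ∑ j, incr (u ∘ wordMap n w') y (p j)) := by
    intro w' y
    rw [lintegral_eq_sum_word n]
    gcongr
    calc ∑ w : Fin n → Fin 3, ∫⁻ x, φ (wordMap n w x) (wordMap n w' y) ∂ν
        = ∑ w ∈ Finset.univ.filter fun w => Adj n w' w,
          ∫⁻ x, φ (wordMap n w x) (wordMap n w' y) ∂ν := by
          rw [Finset.sum_filter]
          refine Finset.sum_congr rfl fun w _ => ?_
          split_ifs with h
          · rfl
          · simp [hadj w w' h]
      _ ≤ ∑ w ∈ Finset.univ.filter fun w => Adj n w' w, (2 * cornerEnergy (u ∘ wordMap n w) +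
          2 * ∑ j, incr (u ∘ wordMap n w') y (p j)) := by
          refine Finset.sum_le_sum fun w hw => ?_
          refine (lintegral_mono fun x => hxy w w' (by simpa using hw) x y).trans (le_of_eq ?_)
          rw [lintegral_add_right _ measurable_const, lintegral_const_mul' _ _ (by simp),
            lintegral_finsetSum _ fun i _ => hm w i]
          simp [cornerEnergy]
      _ ≤ _ := by
          rw [Finset.sum_add_distrib, Finset.sum_const, nsmul_eq_mul, ← mul_assoc]
          gcongr
          calc _ ≤ ((9 : ℕ) : ℝ≥0∞) * 2 := by
                gcongr
                exact card_adj_le n w'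
            _ = 18 := by norm_num
  have hcomm : ∑ w' : Fin n → Fin 3, ∑ w ∈ Finset.univ.filter fun w => Adj n w' w,
      2 * cornerEnergy (u ∘ wordMap n w) ≤
      18 * ∑ w : Fin n → Fin 3, cornerEnergy (u ∘ wordMap n w) := by
    simp only [Finset.sum_filter]
    rw [Finset.sum_comm, Finset.mul_sum]
    refine Finset.sum_le_sum fun w _ => ?_
    rw [← Finset.sum_filter, Finset.sum_const, nsmul_eq_mul, ← mul_assoc]
    gcongr
    have hcard : (Finset.univ.filter fun w' => Adj n w' w).card ≤ 9 := by
      refine le_trans (Finset.card_le_card fun w' hw' => ?_) (card_adj_le n w)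
      rw [Finset.mem_filter] at hw' ⊢
      exact ⟨hw'.1, hw'.2.symm⟩
    calc _ ≤ ((9 : ℕ) : ℝ≥0∞) * 2 := by gcongr
      _ = 18 := by norm_num
  rw [lintegral_eq_sum_word n]
  calc _ ≤ 3⁻¹ ^ n * ∑ w' : Fin n → Fin 3, 3⁻¹ ^ n *
        (∑ w ∈ Finset.univ.filter fun w => Adj n w' w,
          2 * cornerEnergy (u ∘ wordMap n w) + 18 * cornerEnergy (u ∘ wordMap n w')) := by
        gcongr with w' _
        refine (lintegral_mono (hx w')).trans (le_of_eq ?_)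
        rw [lintegral_const_mul' _ _ (by simp), lintegral_add_left measurable_const,
          lintegral_const_mul' _ _ (by simp), lintegral_finsetSum _ fun i _ => hm w' i]
        simp [cornerEnergy]
    _ ≤ 3⁻¹ ^ n * (3⁻¹ ^ n * (18 * ∑ w : Fin n → Fin 3, cornerEnergy (u ∘ wordMap n w) +
        18 * ∑ w : Fin n → Fin 3, cornerEnergy (u ∘ wordMap n w))) := by
        rw [← Finset.mul_sum, Finset.sum_add_distrib, ← Finset.mul_sum]
        gcongr
    _ = _ := by
        rw [← add_mul, ← mul_assoc, ← mul_assoc, ← mul_pow,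
          ← ENNReal.mul_inv (by simp) (by simp)]
        norm_num
        ring

theorem nearEnergy_succ_le (n : ℕ) {u : K → ℝ} (hu : Continuous u) :
    nearEnergy (n + 1) u ≤
      36 * 9⁻¹ ^ n * ∑ w : Fin n → Fin 3, cornerEnergy (u ∘ wordMap n w) := by
  refine lintegral_le_of_adj n hu (fun x y => ?_) fun w w' h x y => ?_
  · rw [nearIncr]
    split_ifs
    · exact le_rfl
    · exact zero_le
  · rw [nearIncr, if_neg]
    exact fun hd => h (adj_of_dist_le hd).symm

theorem nearEnergy_zero_le {u : K → ℝ} (hu : Continuous u) :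
    nearEnergy 0 u ≤ 36 * ∑ w : Fin 0 → Fin 3, cornerEnergy (u ∘ wordMap 0 w) := by
  have := lintegral_le_of_adj (φ := nearIncr 0 u) 0 hu (fun x y => ?_) fun w w' h x y => ?_
  · rw [pow_zero, mul_one] at this
    exact this
  · rw [nearIncr]
    split_ifs
    · exact le_rfl
    · exact zero_le
  · exact absurd ⟨0, 0, by rw [Subsingleton.elim w w']⟩ h

/-- Summing over n first, each shift of F contributes at most ∑ F, and the weights r^m sum to (1 -
r)⁻¹. -/
theorem tsum_tsum_shift_le (r : ℝ≥0∞) (F : ℕ → ℝ≥0∞) :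
    ∑' n : ℕ, ∑' m : ℕ, r ^ m * F (n + m) ≤ (1 - r)⁻¹ * ∑' k, F k := by
  rw [ENNReal.tsum_comm]
  simp only [ENNReal.tsum_mul_left]
  calc ∑' m : ℕ, r ^ m * ∑' n : ℕ, F (n + m) ≤ ∑' m : ℕ, r ^ m * ∑' k : ℕ, F k := by
        exact ENNReal.tsum_le_tsum fun m => mul_le_mul' le_rfl
          (ENNReal.tsum_comp_le_tsum_of_injective (add_left_injective m) F)
    _ = _ := by rw [ENNReal.tsum_mul_right, ENNReal.tsum_geometric]

theorem tsum_cornerEnergy_le {β : ℝ} (hβ : α < β) {u : K → ℝ} (hu : Continuous u) :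
    ∑' n : ℕ, (ratio β : ℝ≥0∞) ^ n * ∑ w : Fin n → Fin 3, cornerEnergy (u ∘ wordMap n w) ≤
      18 * discreteEnergy β u := by
  have h1 : (1 : ℝ≥0∞) ≤ ratio β := by exact_mod_cast (one_lt_ratio hβ).le
  have h3 : (1 - 2 / 3 : ℝ≥0∞)⁻¹ = 3 := by
    have e2 : (2 / 3 : ℝ≥0∞) = ENNReal.ofReal (2 / 3) := by
      rw [ENNReal.ofReal_div_of_pos (by norm_num)]; simp
    rw [e2, ← ENNReal.ofReal_one, ← ENNReal.ofReal_sub _ (by norm_num),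
      ← ENNReal.ofReal_inv_of_pos (by norm_num)]
    norm_num
  calc _ ≤ ∑' n : ℕ, (ratio β : ℝ≥0∞) ^ n *
        (6 * ∑' m : ℕ, (2 / 3) ^ m * ENNReal.ofReal (cellSum (n + m + 1) u)) := by
        gcongr with n
        exact sum_cornerEnergy_le n hu
    _ = 6 * ∑' n : ℕ, ∑' m : ℕ, (2 / 3) ^ m *
        ((ratio β : ℝ≥0∞) ^ n * ENNReal.ofReal (cellSum (n + m + 1) u)) := by
        rw [← ENNReal.tsum_mul_left]
        refine tsum_congr fun n => ?_
        rw [mul_left_comm, ← ENNReal.tsum_mul_left]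
        congr 1
        exact tsum_congr fun m => mul_left_comm _ _ _
    -- Since t ≥ 1 the weight t^n may be raised to t^(n+m+1), the weight belonging to level n + m +
    -- 1 in E_β.
    _ ≤ 6 * ∑' n : ℕ, ∑' m : ℕ, (2 / 3) ^ m *
        ((ratio β : ℝ≥0∞) ^ (n + m + 1) * ENNReal.ofReal (cellSum (n + m + 1) u)) := by
        gcongr with n m
        omega
    _ ≤ 6 * ((1 - 2 / 3)⁻¹ * discreteEnergy β u) := by
        rw [discreteEnergy_eq]
        gcongr
        exact tsum_tsum_shift_le (2 / 3) fun k =>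
          (ratio β : ℝ≥0∞) ^ (k + 1) * ENNReal.ofReal (cellSum (k + 1) u)
    _ = _ := by
        rw [h3, ← mul_assoc]
        norm_num

theorem stableEnergy_le_discreteEnergy {β : ℝ} (hβ : α < β) :
    ∃ C : ℝ≥0, ∀ u : K → ℝ, Continuous u → stableEnergy β u ≤ C * discreteEnergy β u := by
  refine ⟨(9 * ratio β * 36 + (9 * ratio β) ^ 2 * 36) * 18, fun u hu => ?_⟩
  set t : ℝ≥0∞ := (ratio β : ℝ≥0∞) with ht
  set J : ℕ → ℝ≥0∞ := fun n => ∑ w : Fin n → Fin 3, cornerEnergy (u ∘ wordMap n w) with hJ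
  have h0 : J 0 ≤ ∑' n : ℕ, t ^ n * J n := by
    have := ENNReal.le_tsum (f := fun n : ℕ => t ^ n * J n) 0
    simpa using this
  calc stableEnergy β u ≤ ∑' n : ℕ, (9 * t) ^ (n + 1) * nearEnergy n u :=
        stableEnergy_le_tsum hβ hu
    -- Adjacency at level n requires distance at most 2^(-n-1), so scale 0 is treated separately.
    _ = 9 * t * nearEnergy 0 u + ∑' n : ℕ, (9 * t) ^ (n + 1 + 1) * nearEnergy (n + 1) u := by
        rw [tsum_eq_zero_add' ENNReal.summable]
        simp
    _ ≤ 9 * t * (36 * J 0) + ∑' n : ℕ, (9 * t) ^ (n + 1 + 1) * (36 * 9⁻¹ ^ n * J n) := by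
        gcongr with n
        · exact nearEnergy_zero_le hu
        · exact nearEnergy_succ_le n hu
    _ = 9 * t * 36 * J 0 + (9 * t) ^ 2 * 36 * ∑' n : ℕ, t ^ n * J n := by
        rw [← ENNReal.tsum_mul_left, mul_assoc (9 * t)]
        congr 1
        refine tsum_congr fun n => ?_
        have : (9 : ℝ≥0∞) ^ n * 9⁻¹ ^ n = 1 := by
          rw [← mul_pow, ENNReal.mul_inv_cancel (by simp) (by simp), one_pow]
        calc _ = (9 * t) ^ 2 * 36 * (t ^ n * J n) * (9 ^ n * 9⁻¹ ^ n) := by ring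
          _ = _ := by rw [this, mul_one]
    _ ≤ 9 * t * 36 * (18 * discreteEnergy β u) +
        (9 * t) ^ 2 * 36 * (18 * discreteEnergy β u) := by
        have := tsum_cornerEnergy_le hβ hu
        gcongr
        exact h0.trans this
    _ = _ := by
        push_cast
        ring

/-! #### The discrete energy is dominated by the stable-like energy -/

/-- `∑_{w ∈ Wₙ} ∫∫ (u(f_w x) - u(f_w y))² ν(dx) ν(dy)`. -/
noncomputable def oscEnergy (n : ℕ) (u : K → ℝ) : ℝ≥0∞ :=
  ∑ w : Fin n → Fin 3, ∫⁻ y, ∫⁻ x, incr (u ∘ wordMap n w) x y ∂ν ∂ν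

/-- Two points of the same level-n cell are within 2⁻ⁿ, so the diagonal cell pairs of `nearEnergy`
already give the bound. -/
theorem oscEnergy_le (n : ℕ) (u : K → ℝ) : oscEnergy n u ≤ 9 ^ n * nearEnergy n u := by
  have h : 3⁻¹ ^ n * (3⁻¹ ^ n * oscEnergy n u) ≤ nearEnergy n u := by
    rw [nearEnergy, lintegral_eq_sum_word n, oscEnergy, Finset.mul_sum]
    gcongr with w _
    rw [← lintegral_const_mul' _ _ (by simp)]
    refine lintegral_mono fun y => ?_
    rw [lintegral_eq_sum_word n fun x => nearIncr n u x (wordMap n w y)]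
    refine mul_le_mul' le_rfl ?_
    refine le_trans ?_ (Finset.single_le_sum
      (f := fun w' => ∫⁻ x, nearIncr n u (wordMap n w' x) (wordMap n w y) ∂ν)
      (fun _ _ => zero_le) (Finset.mem_univ w))
    refine lintegral_mono fun x => ?_
    rw [nearIncr, if_pos]
    · rfl
    · rw [dist_wordMap, one_div, inv_pow, div_eq_mul_inv]
      exact mul_le_of_le_one_left (by positivity) (dist_le_one _ _)
  have h9 : (9 : ℝ≥0∞) ^ n * (3⁻¹ ^ n * 3⁻¹ ^ n) = 1 := by
    rw [← mul_pow, ← mul_pow, ← ENNReal.mul_inv (by simp) (by simp)]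
    norm_num
    rw [ENNReal.mul_inv_cancel (by simp) (by simp), one_pow]
  calc oscEnergy n u = 9 ^ n * (3⁻¹ ^ n * 3⁻¹ ^ n) * oscEnergy n u := by rw [h9, one_mul]
    _ = 9 ^ n * (3⁻¹ ^ n * (3⁻¹ ^ n * oscEnergy n u)) := by ring
    _ ≤ _ := mul_le_mul' le_rfl h

theorem integrable_of_continuous {h : K → ℝ} (hc : Continuous h) : Integrable h ν :=
  hc.integrable_of_hasCompactSupport (HasCompactSupport.of_compactSpace h)

/-- Non-negativity of the variance. -/
theorem ofReal_sq_integral_le {h : K → ℝ} (hc : Continuous h) :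
    ENNReal.ofReal ((∫ x, h x ∂ν) ^ 2) ≤ ∫⁻ x, ENNReal.ofReal (h x ^ 2) ∂ν := by
  rw [← ofReal_integral_eq_lintegral_ofReal (integrable_of_continuous (by fun_prop : Continuous fun x => h x ^ 2))
    (ae_of_all _ fun x => sq_nonneg _)]
  refine ENNReal.ofReal_le_ofReal ?_
  set m := ∫ x, h x ∂ν with hm
  have h1 : 0 ≤ ∫ x, (h x - m) ^ 2 ∂ν := integral_nonneg fun x => sq_nonneg _
  have h2 : ∫ x, (h x - m) ^ 2 ∂ν = ∫ x, h x ^ 2 ∂ν - m ^ 2 := by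
    have : ∀ x, (h x - m) ^ 2 = h x ^ 2 - (2 * m) * h x + m ^ 2 := fun x => by ring
    simp only [this]
    rw [integral_add, integral_sub, integral_const_mul, ← hm]
    · simp
      ring
    · exact integrable_of_continuous (by fun_prop)
    · exact integrable_of_continuous (by fun_prop)
    · exact integrable_of_continuous (by fun_prop)
    · exact integrable_of_continuous (by fun_prop)
  linarith

/-- Jensen in both variables. The factor 3 appears because averaging over a subcell is three times
integrating over it. -/
theorem ofReal_sq_integral_f_sub_le {g : K → ℝ} (hg : Continuous g) (i : Fin 3) :
    ENNReal.ofReal ((∫ x, g (f i x) ∂ν - ∫ x, g x ∂ν) ^ 2) ≤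
      3 * ∫⁻ y, ∫⁻ x, incr g x y ∂ν ∂ν := by
  have hgi : Continuous fun x => g (f i x) := hg.comp (continuous_f i)
  have e1 : ∫ x, g (f i x) ∂ν - ∫ x, g x ∂ν = ∫ y, (∫ x, g (f i x) ∂ν - g y) ∂ν := by
    rw [integral_sub (integrable_const _) (integrable_of_continuous hg)]
    simp
  have e2 : ∀ y, ∫ x, g (f i x) ∂ν - g y = ∫ x, (g (f i x) - g y) ∂ν := fun y => by
    rw [integral_sub (integrable_of_continuous hgi) (integrable_const _)]
    simp
  rw [e1, ← lintegral_const_mul' _ _ (by simp)]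
  refine (ofReal_sq_integral_le (by fun_prop)).trans (lintegral_mono fun y => ?_)
  rw [e2]
  refine (ofReal_sq_integral_le (hgi.sub continuous_const)).trans ?_
  rw [lintegral_eq_sum_f fun x => incr g x y, ← mul_assoc,
    ENNReal.mul_inv_cancel (by simp) (by simp), one_mul]
  exact Finset.single_le_sum (f := fun k => ∫⁻ x, incr g (f k x) y ∂ν)
    (fun _ _ => zero_le) (Finset.mem_univ i)

theorem continuous_iterate_f (i : Fin 3) (M : ℕ) : Continuous (f i)^[M] :=
  (continuous_f i).iterate M

theorem dist_iterate_f_le (i : Fin 3) (M : ℕ) (x : K) :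
    dist ((f i)^[M] x) (p i) ≤ (1 / 2) ^ M := by
  induction M with
  | zero => simpa using dist_le_one x (p i)
  | succ M ih =>
    have h := dist_f i ((f i)^[M] x) (p i)
    rw [f_p_self] at h
    rw [Function.iterate_succ_apply', h, pow_succ]
    linarith

/-- The average of `g` over the cell `fᵢᴹ(K)`. -/
noncomputable def cornerAvg (i : Fin 3) (M : ℕ) (g : K → ℝ) : ℝ := ∫ x, g ((f i)^[M] x) ∂ν

theorem cornerAvg_succ (i : Fin 3) (M : ℕ) (g : K → ℝ) :
    cornerAvg i (M + 1) g = cornerAvg i M (g ∘ f i) := by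
  simp only [cornerAvg, Function.iterate_succ_apply', Function.comp_apply]

theorem tendsto_cornerAvg (i : Fin 3) {g : K → ℝ} (hg : Continuous g) :
    Tendsto (fun M => cornerAvg i M g) atTop (𝓝 (g (p i))) := by
  obtain ⟨C, hC⟩ := isCompact_univ.exists_bound_of_continuousOn hg.continuousOn
  have h : Tendsto (fun M => ∫ x, g ((f i)^[M] x) ∂ν) atTop (𝓝 (∫ _, g (p i) ∂ν)) := by
    refine tendsto_integral_of_dominated_convergence (fun _ => C)
      (fun M => (hg.comp (continuous_iterate_f i M)).aestronglyMeasurable) (integrable_const _)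
      (fun M => ae_of_all _ fun x => hC _ (Set.mem_univ _)) (ae_of_all _ fun x => ?_)
    refine (hg.tendsto _).comp (tendsto_iff_dist_tendsto_zero.2 ?_)
    exact squeeze_zero (fun _ => dist_nonneg) (fun M => dist_iterate_f_le i M x)
      (tendsto_pow_atTop_nhds_zero_of_lt_one (by norm_num) (by norm_num))
  have e : ∫ _, g (p i) ∂ν = g (p i) := by simp
  rwa [e] at h

/-- Telescoping of averages over the cells shrinking to the i-th corner, one level at a time. The
loss per level is s, which can be taken as close to 1 as desired; a fixed loss of 2 would not
suffice for β near α. -/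
theorem sum_cornerAvg_le {s : ℝ≥0} (hs : 1 < s) (i : Fin 3) (M n : ℕ) {u : K → ℝ}
    (hu : Continuous u) :
    ∑ w : Fin n → Fin 3, ENNReal.ofReal
        ((cornerAvg i M (u ∘ wordMap n w) - cornerAvg i 0 (u ∘ wordMap n w)) ^ 2) ≤
      (s / (s - 1) * 3 : ℝ≥0) * ∑ m ∈ Finset.range M, (s : ℝ≥0∞) ^ m * oscEnergy (n + m) u := by
  induction M generalizing n with
  | zero => simp
  | succ M ih =>
    have hs1 : (1 : ℝ) < s := hs
    have hsub : ((s - 1 : ℝ≥0) : ℝ) = s - 1 := by rw [NNReal.coe_sub hs.le]; rfl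
    have key : ∀ a b : ℝ, ENNReal.ofReal ((a + b) ^ 2) ≤
        s * ENNReal.ofReal (a ^ 2) + (s / (s - 1) : ℝ≥0) * ENNReal.ofReal (b ^ 2) := by
      intro a b
      rw [← ENNReal.ofReal_coe_nnreal, ← ENNReal.ofReal_coe_nnreal,
        ← ENNReal.ofReal_mul (by positivity), ← ENNReal.ofReal_mul (by positivity),
        ← ENNReal.ofReal_add (by positivity) (by positivity)]
      refine ENNReal.ofReal_le_ofReal ?_
      rw [NNReal.coe_div, hsub]
      have h0 : (0 : ℝ) < s - 1 := by linarith
      have h1 : s * a ^ 2 + s / (s - 1) * b ^ 2 - (a + b) ^ 2 =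
          ((s - 1) * a - b) ^ 2 / (s - 1) := by
        field_simp
        ring
      have h2 : 0 ≤ ((s - 1) * a - b) ^ 2 / ((s : ℝ) - 1) := by positivity
      linarith
    have hstep : ∀ w : Fin n → Fin 3, ENNReal.ofReal
        ((cornerAvg i (M + 1) (u ∘ wordMap n w) - cornerAvg i 0 (u ∘ wordMap n w)) ^ 2) ≤
        s * ENNReal.ofReal ((cornerAvg i M (u ∘ wordMap n w ∘ f i) -
          cornerAvg i 0 (u ∘ wordMap n w ∘ f i)) ^ 2) +
        (s / (s - 1) : ℝ≥0) * (3 * ∫⁻ y, ∫⁻ x, incr (u ∘ wordMap n w) x y ∂ν ∂ν) := by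
      intro w
      rw [cornerAvg_succ, ← sub_add_sub_cancel _ (cornerAvg i 0 (u ∘ wordMap n w ∘ f i))]
      exact (key _ _).trans (add_le_add le_rfl (mul_le_mul' le_rfl
        (ofReal_sq_integral_f_sub_le (hu.comp (continuous_wordMap n w)) i)))
    have hsum := sum_word_succ' n fun h => ENNReal.ofReal
      ((cornerAvg i M (u ∘ h) - cornerAvg i 0 (u ∘ h)) ^ 2)
    -- The words ending in i are some of the words of length n + 1, so the induction hypothesis at
    -- level n + 1 applies.
    have hle : ∑ w : Fin n → Fin 3, ENNReal.ofReal ((cornerAvg i M (u ∘ wordMap n w ∘ f i) -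
          cornerAvg i 0 (u ∘ wordMap n w ∘ f i)) ^ 2) ≤
        ∑ w : Fin (n + 1) → Fin 3, ENNReal.ofReal ((cornerAvg i M (u ∘ wordMap (n + 1) w) -
          cornerAvg i 0 (u ∘ wordMap (n + 1) w)) ^ 2) := by
      rw [hsum]
      refine Finset.sum_le_sum fun w _ => ?_
      exact Finset.single_le_sum (f := fun k => ENNReal.ofReal
        ((cornerAvg i M (u ∘ wordMap n w ∘ f k) - cornerAvg i 0 (u ∘ wordMap n w ∘ f k)) ^ 2))
        (fun _ _ => zero_le) (Finset.mem_univ i)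
    refine (Finset.sum_le_sum fun w _ => hstep w).trans ?_
    rw [Finset.sum_add_distrib, ← Finset.mul_sum, ← Finset.mul_sum, ← Finset.mul_sum]
    refine (add_le_add_left (mul_le_mul_right (hle.trans (ih (n + 1))) _) _).trans
      (le_of_eq ?_)
    change _ + _ * (3 * oscEnergy n u) = _
    rw [Finset.sum_range_succ', mul_add]
    congr 1
    · rw [mul_left_comm, Finset.mul_sum]
      congr 1
      refine Finset.sum_congr rfl fun m _ => ?_
      rw [pow_succ', mul_assoc, add_right_comm, add_assoc]
    · push_cast
      simp [mul_assoc]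

/-- Each vertex value is compared with the average over the whole cell, which does not depend on the
corner. Bounding all nine pairs by 2a² + 2b² gives 12, and the three corners turn it into 36. -/
theorem ofReal_cellSum_le {s : ℝ≥0} (hs : 1 < s) (n : ℕ) {u : K → ℝ} (hu : Continuous u) :
    ENNReal.ofReal (cellSum n u) ≤
      (36 * (s / (s - 1) * 3) : ℝ≥0) * ∑' m : ℕ, (s : ℝ≥0∞) ^ m * oscEnergy (n + m) u := by
  have hlim : ∀ i, ∑ w : Fin n → Fin 3, ENNReal.ofReal
        ((u (wordMap n w (p i)) - cornerAvg i 0 (u ∘ wordMap n w)) ^ 2) ≤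
      (s / (s - 1) * 3 : ℝ≥0) * ∑' m : ℕ, (s : ℝ≥0∞) ^ m * oscEnergy (n + m) u := by
    intro i
    have h := tendsto_finsetSum Finset.univ fun (w : Fin n → Fin 3) _ =>
      ENNReal.tendsto_ofReal (((tendsto_cornerAvg i
        (hu.comp (continuous_wordMap n w))).sub_const (cornerAvg i 0 (u ∘ wordMap n w))).pow 2)
    refine le_of_tendsto' h fun M => (sum_cornerAvg_le hs i M n hu).trans ?_
    gcongr
    exact ENNReal.sum_le_tsum _
  have havg : ∀ i j (g : K → ℝ), cornerAvg i 0 g = cornerAvg j 0 g := fun i j g => rfl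
  have hij : ∀ (g : K → ℝ), ENNReal.ofReal (∑ i, ∑ j, (g (p i) - g (p j)) ^ 2) ≤
      12 * ∑ i, ENNReal.ofReal ((g (p i) - cornerAvg i 0 g) ^ 2) := by
    intro g
    have e : (12 : ℝ≥0∞) = ENNReal.ofReal 12 := by simp
    rw [← ENNReal.ofReal_sum_of_nonneg fun _ _ => sq_nonneg _, e,
      ← ENNReal.ofReal_mul (by norm_num)]
    refine ENNReal.ofReal_le_ofReal ?_
    simp only [Fin.sum_univ_three, havg 1 0, havg 2 0]
    generalize cornerAvg 0 0 g = m
    generalize g (p 0) = a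
    generalize g (p 1) = b
    generalize g (p 2) = c
    nlinarith [sq_nonneg (a - m + (b - m)), sq_nonneg (a - m + (c - m)),
      sq_nonneg (c - m + (b - m)), sq_nonneg (a - m), sq_nonneg (b - m), sq_nonneg (c - m)]
  calc ENNReal.ofReal (cellSum n u)
      = ∑ w : Fin n → Fin 3, ENNReal.ofReal (∑ i, ∑ j,
          ((u ∘ wordMap n w) (p i) - (u ∘ wordMap n w) (p j)) ^ 2) :=
        ENNReal.ofReal_sum_of_nonneg fun w _ => by positivity
    _ ≤ ∑ w : Fin n → Fin 3, 12 * ∑ i, ENNReal.ofReal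
          (((u ∘ wordMap n w) (p i) - cornerAvg i 0 (u ∘ wordMap n w)) ^ 2) :=
        Finset.sum_le_sum fun w _ => hij _
    _ = 12 * ∑ i, ∑ w : Fin n → Fin 3, ENNReal.ofReal
          ((u (wordMap n w (p i)) - cornerAvg i 0 (u ∘ wordMap n w)) ^ 2) := by
        rw [← Finset.mul_sum, Finset.sum_comm]
        rfl
    _ ≤ 12 * ∑ _i : Fin 3, (s / (s - 1) * 3 : ℝ≥0) *
          ∑' m : ℕ, (s : ℝ≥0∞) ^ m * oscEnergy (n + m) u := by
        gcongr with i _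
        exact hlim i
    _ = _ := by
        rw [Finset.sum_const, Finset.card_univ, Fintype.card_fin, nsmul_eq_mul, ENNReal.coe_mul,
          ← mul_assoc, ← mul_assoc]
        norm_num

theorem discreteEnergy_le_stableEnergy {β : ℝ} (hβ : α < β) :
    ∃ C : ℝ≥0, ∀ u : K → ℝ, Continuous u → discreteEnergy β u ≤ C * stableEnergy β u := by
  -- The loss s lies strictly between 1 and t, so that r = s/t < 1 makes the convolution summable.
  obtain ⟨s, hs1, hst⟩ := exists_between (one_lt_ratio hβ)
  have ht0 : ratio β ≠ 0 := (zero_lt_one.trans (one_lt_ratio hβ)).ne'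
  set r : ℝ≥0 := s / ratio β with hr
  have hr1 : r < 1 := by
    rw [hr, div_lt_one (pos_iff_ne_zero.2 ht0)]
    exact hst
  have hrs : (s : ℝ≥0∞) = r * ratio β := by
    rw [← ENNReal.coe_mul, hr, div_mul_cancel₀ _ ht0]
  obtain ⟨c, hc⟩ : ∃ c : ℝ≥0, c = 36 * (s / (s - 1) * 3) := ⟨_, rfl⟩
  have hD : (1 - (r : ℝ≥0∞))⁻¹ = ((1 - r)⁻¹ : ℝ≥0) := by
    rw [ENNReal.coe_inv (tsub_pos_of_lt hr1).ne', ENNReal.coe_sub, ENNReal.coe_one]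
  refine ⟨c * (1 - r)⁻¹ * 2, fun u hu => ?_⟩
  set t : ℝ≥0∞ := (ratio β : ℝ≥0∞) with ht
  calc discreteEnergy β u
      ≤ ∑' n : ℕ, t ^ n * ENNReal.ofReal (cellSum n u) := by
        rw [discreteEnergy_eq]
        exact ENNReal.tsum_comp_le_tsum_of_injective (add_left_injective 1)
          fun n => t ^ n * ENNReal.ofReal (cellSum n u)
    _ ≤ ∑' n : ℕ, t ^ n * (c * ∑' m : ℕ, (s : ℝ≥0∞) ^ m * (9 ^ (n + m) * nearEnergy (n + m) u)) := by
        gcongr with n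
        refine (ofReal_cellSum_le hs1 n hu).trans ?_
        rw [← hc]
        gcongr with m
        exact oscEnergy_le _ _
    _ = c * ∑' n : ℕ, ∑' m : ℕ, (r : ℝ≥0∞) ^ m * ((9 * t) ^ (n + m) * nearEnergy (n + m) u) := by
        rw [← ENNReal.tsum_mul_left]
        refine tsum_congr fun n => ?_
        rw [mul_left_comm, ← ENNReal.tsum_mul_left]
        congr 1
        refine tsum_congr fun m => ?_
        rw [hrs]
        ring
    _ ≤ c * ((1 - (r : ℝ≥0∞))⁻¹ * (2 * stableEnergy β u)) :=
        mul_le_mul' le_rfl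
          ((tsum_tsum_shift_le r fun k => (9 * t) ^ k * nearEnergy k u).trans
            (mul_le_mul' le_rfl (tsum_le_stableEnergy hβ hu)))
    _ = _ := by
        rw [hD, ENNReal.coe_mul, ENNReal.coe_mul, ENNReal.coe_ofNat, mul_assoc, mul_assoc]

end Gasket

namespace Gasket

/-! ### Abel summation and monotonicity in `β` -/

/-- The continuous version is unique because ν charges every non-empty open set. -/
theorem extend_eq (E : (K → ℝ) → ℝ≥0∞) {u : L2} {v : C(K, ℝ)} (h : ⇑u =ᵐ[ν] ⇑v) :
    extend E u = E v := by
  have hex : ∃ v : C(K, ℝ), ⇑u =ᵐ[ν] ⇑v := ⟨v, h⟩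
  rw [extend, dif_pos hex]
  congr 1
  exact (hex.choose.continuous.ae_eq_iff_eq ν v.continuous).1 (hex.choose_spec.symm.trans h)

theorem extend_eq_top (E : (K → ℝ) → ℝ≥0∞) {u : L2} (h : ¬ ∃ v : C(K, ℝ), ⇑u =ᵐ[ν] ⇑v) :
    extend E u = ⊤ := by
  rw [extend, dif_neg h]

theorem exists_of_extend_lt_top {E : (K → ℝ) → ℝ≥0∞} {u : L2} (h : extend E u < ⊤) :
    ∃ v : C(K, ℝ), ⇑u =ᵐ[ν] ⇑v ∧ extend E u = E v := by
  by_contra hne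
  refine h.ne (extend_eq_top E fun ⟨v, hv⟩ => hne ⟨v, hv, extend_eq E hv⟩)

/-- The ratio `5⁻¹ 2^β` of consecutive weights of the rescaled level energies. -/
noncomputable def decay (β : ℝ) : ℝ≥0 := ⟨(5 : ℝ)⁻¹ * (2 : ℝ) ^ β, by positivity⟩

theorem coe_decay (β : ℝ) : (decay β : ℝ) = (5 : ℝ)⁻¹ * (2 : ℝ) ^ β := rfl

theorem decay_mono {β γ : ℝ} (h : β ≤ γ) : decay β ≤ decay γ := by
  rw [← NNReal.coe_le_coe, coe_decay, coe_decay]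
  exact mul_le_mul_of_nonneg_left (Real.rpow_le_rpow_of_exponent_le (by norm_num) h)
    (by norm_num)

theorem decay_βstar : decay βstar = 1 := by
  rw [← NNReal.coe_inj, coe_decay, βstar, Real.rpow_def_of_pos (by norm_num),
    mul_div_cancel₀ _ (Real.log_pos (by norm_num)).ne', Real.exp_log (by norm_num)]
  norm_num

theorem decay_lt_one {β : ℝ} (h : β < βstar) : decay β < 1 := by
  rw [← decay_βstar, ← NNReal.coe_lt_coe, coe_decay, coe_decay]
  exact mul_lt_mul_of_pos_left (Real.rpow_lt_rpow_of_exponent_lt (by norm_num) h)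
    (by norm_num)

theorem continuous_decay : Continuous decay := by
  refine Continuous.subtype_mk ?_ _
  exact continuous_const.mul (Real.continuous_const_rpow (by norm_num))

theorem ofReal_one_sub_decay (β : ℝ) :
    ENNReal.ofReal (1 - (5 : ℝ)⁻¹ * (2 : ℝ) ^ β) = 1 - (decay β : ℝ≥0∞) := by
  rw [ENNReal.ofReal_sub _ (by positivity), ENNReal.ofReal_one, ← coe_decay,
    ENNReal.ofReal_coe_nnreal]

/-- Uses 2^(β-α) = (5⁻¹ 2^β) · (5/3). -/
theorem discreteEnergy_eq_tsum_levelEnergy (β : ℝ) (u : K → ℝ) :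
    discreteEnergy β u = ∑' n : ℕ, (decay β : ℝ≥0∞) ^ (n + 1) * levelEnergy (n + 1) u := by
  refine tsum_congr fun n => ?_
  have h : (2 : ℝ) ^ (β - α) = decay β * (5 / 3) := by
    rw [Real.rpow_sub (by norm_num), two_rpow_α, coe_decay]
    ring
  rw [Real.rpow_mul (by norm_num), Real.rpow_natCast, h, mul_pow, mul_assoc,
    ENNReal.ofReal_mul (by positivity), ENNReal.ofReal_pow (by positivity),
    ENNReal.ofReal_coe_nnreal, levelEnergy]

/-- The increments of `n ↦ 𝔈ₙ₊₁(u,u)`, starting with `𝔈₁(u,u)` itself. -/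
noncomputable def levelIncr (u : K → ℝ) : ℕ → ℝ≥0∞
  | 0 => levelEnergy 1 u
  | k + 1 => levelEnergy (k + 2) u - levelEnergy (k + 1) u

theorem sum_levelIncr (u : K → ℝ) (n : ℕ) :
    ∑ k ∈ Finset.range (n + 1), levelIncr u k = levelEnergy (n + 1) u := by
  induction n with
  | zero => simp [levelIncr]
  | succ n ih =>
    rw [Finset.sum_range_succ, ih, levelIncr]
    exact add_tsub_cancel_of_le (monotone_levelEnergy u (Nat.le_succ _))

/-- Abel summation: after exchanging the sums, c_k is multiplied by the geometric tail r^(k+1) (1 -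
r)⁻¹. -/
theorem tsum_pow_mul_sum_range (r : ℝ≥0∞) (c : ℕ → ℝ≥0∞) :
    ∑' n : ℕ, r ^ (n + 1) * ∑ k ∈ Finset.range (n + 1), c k =
      (1 - r)⁻¹ * ∑' k : ℕ, r ^ (k + 1) * c k := by
  have h1 : ∀ n, r ^ (n + 1) * ∑ k ∈ Finset.range (n + 1), c k =
      ∑' k, if k ≤ n then r ^ (n + 1) * c k else 0 := by
    intro n
    rw [tsum_eq_sum (s := Finset.range (n + 1)), Finset.mul_sum]
    · refine Finset.sum_congr rfl fun k hk => ?_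
      rw [if_pos (Nat.lt_succ_iff.1 (Finset.mem_range.1 hk))]
    · intro k hk
      rw [if_neg fun h => hk (Finset.mem_range.2 (Nat.lt_succ_of_le h))]
  simp only [h1]
  rw [ENNReal.tsum_comm, ← ENNReal.tsum_mul_left]
  refine tsum_congr fun k => ?_
  have hsplit := Summable.sum_add_tsum_nat_add'
    (f := fun n => if k ≤ n then r ^ (n + 1) * c k else 0) (k := k) ENNReal.summable
  rw [← hsplit, Finset.sum_eq_zero, zero_add]
  · have h2 : ∀ m, (if k ≤ m + k then r ^ (m + k + 1) * c k else 0) =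
        r ^ m * (r ^ (k + 1) * c k) := fun m => by
      rw [if_pos (Nat.le_add_left _ _)]
      ring
    simp only [h2]
    rw [ENNReal.tsum_mul_right, ENNReal.tsum_geometric]
  · intro m hm
    rw [if_neg (not_le.2 (Finset.mem_range.1 hm))]

/-- `(1 - 5⁻¹ 2^β) E_β(u,u)`. -/
noncomputable def scaledEnergy (β : ℝ) (u : K → ℝ) : ℝ≥0∞ :=
  ENNReal.ofReal (1 - (5 : ℝ)⁻¹ * (2 : ℝ) ^ β) * discreteEnergy β u

theorem one_sub_decay_ne_zero {β : ℝ} (h : β < βstar) : (1 : ℝ≥0∞) - decay β ≠ 0 := by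
  have : (decay β : ℝ≥0∞) < 1 := by exact_mod_cast decay_lt_one h
  exact (tsub_pos_of_lt this).ne'

/-- The factor 1 - 5⁻¹ 2^β must be non-zero: otherwise 0 · ∞ = 0 would destroy the value +∞ at
functions without continuous version. -/
theorem scaledForm_eq {β : ℝ} (h : β < βstar) : scaledForm β = extend (scaledEnergy β) := by
  funext u
  by_cases hu : ∃ v : C(K, ℝ), ⇑u =ᵐ[ν] ⇑v
  · obtain ⟨v, hv⟩ := hu
    rw [scaledForm, extend_eq _ hv, extend_eq _ hv, scaledEnergy]
  · rw [scaledForm, extend_eq_top _ hu, extend_eq_top _ hu, ENNReal.mul_top]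
    rw [ofReal_one_sub_decay]
    exact one_sub_decay_ne_zero h

theorem scaledEnergy_eq {β : ℝ} (h : β < βstar) (u : K → ℝ) :
    scaledEnergy β u = ∑' k : ℕ, (decay β : ℝ≥0∞) ^ (k + 1) * levelIncr u k := by
  rw [scaledEnergy, ofReal_one_sub_decay, discreteEnergy_eq_tsum_levelEnergy]
  simp only [← sum_levelIncr]
  rw [tsum_pow_mul_sum_range, ← mul_assoc, ENNReal.mul_inv_cancel (one_sub_decay_ne_zero h)
    (ne_top_of_le_ne_top ENNReal.one_ne_top tsub_le_self), one_mul]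

theorem localEnergy_eq (u : K → ℝ) : localEnergy u = ∑' k, levelIncr u k := by
  refine tendsto_nhds_unique ((tendsto_add_atTop_iff_nat 1).2 (tendsto_levelEnergy u)) ?_
  simp only [← sum_levelIncr]
  exact (tendsto_add_atTop_iff_nat 1).2 ENNReal.summable.hasSum.tendsto_sum_nat

theorem scaledEnergy_mono {β γ : ℝ} (h : β ≤ γ) (hγ : γ < βstar) (u : K → ℝ) :
    scaledEnergy β u ≤ scaledEnergy γ u := by
  rw [scaledEnergy_eq (h.trans_lt hγ), scaledEnergy_eq hγ]
  gcongr
  exact decay_mono h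

theorem scaledEnergy_le_localEnergy {β : ℝ} (h : β < βstar) (u : K → ℝ) :
    scaledEnergy β u ≤ localEnergy u := by
  rw [scaledEnergy_eq h, localEnergy_eq]
  refine ENNReal.tsum_le_tsum fun k => mul_le_of_le_one_left' (pow_le_one' ?_ _)
  exact_mod_cast (decay_lt_one h).le

/-- From below a finite partial sum suffices, being continuous in the ratio; from above the limit is
already a bound. The argument also covers an infinite limit. -/
theorem tendsto_scaledEnergy (u : K → ℝ) :
    Tendsto (fun β => scaledEnergy β u) (𝓝[<] βstar) (𝓝 (localEnergy u)) := by
  have hlt : ∀ᶠ β in 𝓝[<] βstar, β < βstar := self_mem_nhdsWithin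
  refine tendsto_order.2 ⟨fun a ha => ?_, fun a ha => ?_⟩
  · rw [localEnergy_eq] at ha
    obtain ⟨N, hN⟩ := ((tendsto_order.1
      (ENNReal.summable (f := levelIncr u)).hasSum.tendsto_sum_nat).1 a ha).exists
    have hd : Tendsto (fun β => (decay β : ℝ≥0∞)) (𝓝[<] βstar) (𝓝 1) := by
      have := (continuous_decay.tendsto βstar).mono_left (nhdsWithin_le_nhds (s := Set.Iio βstar))
      rw [decay_βstar] at this
      have := ENNReal.tendsto_coe.2 this
      rwa [ENNReal.coe_one] at this
    have hs : Tendsto (fun β => ∑ k ∈ Finset.range N, (decay β : ℝ≥0∞) ^ (k + 1) * levelIncr u k)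
        (𝓝[<] βstar) (𝓝 (∑ k ∈ Finset.range N, levelIncr u k)) := by
      refine tendsto_finsetSum _ fun k _ => ?_
      have := ENNReal.Tendsto.mul_const (b := levelIncr u k)
        (((ENNReal.continuous_pow (k + 1)).tendsto 1).comp hd) (Or.inl (by simp))
      simpa using this
    filter_upwards [(tendsto_order.1 hs).1 a hN, hlt] with β h1 h2
    rw [scaledEnergy_eq h2]
    exact h1.trans_le (ENNReal.sum_le_tsum _)
  · filter_upwards [hlt] with β h
    exact (scaledEnergy_le_localEnergy h u).trans_lt ha

theorem scaledForm_mono {β γ : ℝ} (h : β ≤ γ) (hγ : γ < βstar) (u : L2) :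
    scaledForm β u ≤ scaledForm γ u := by
  rw [scaledForm_eq (h.trans_lt hγ), scaledForm_eq hγ]
  by_cases hu : ∃ v : C(K, ℝ), ⇑u =ᵐ[ν] ⇑v
  · obtain ⟨v, hv⟩ := hu
    rw [extend_eq _ hv, extend_eq _ hv]
    exact scaledEnergy_mono h hγ v
  · rw [extend_eq_top _ hu, extend_eq_top _ hu]

theorem scaledForm_le_localForm {β : ℝ} (h : β < βstar) (u : L2) :
    scaledForm β u ≤ localForm u := by
  rw [scaledForm_eq h, localForm]
  by_cases hu : ∃ v : C(K, ℝ), ⇑u =ᵐ[ν] ⇑v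
  · obtain ⟨v, hv⟩ := hu
    rw [extend_eq _ hv, extend_eq _ hv]
    exact scaledEnergy_le_localEnergy h v
  · rw [extend_eq_top _ hu, extend_eq_top _ hu]

theorem tendsto_scaledForm (u : L2) :
    Tendsto (fun β => scaledForm β u) (𝓝[<] βstar) (𝓝 (localForm u)) := by
  have heq : ∀ᶠ β in 𝓝[<] βstar, extend (scaledEnergy β) u = scaledForm β u := by
    filter_upwards [self_mem_nhdsWithin] with β h
    rw [scaledForm_eq h]
  refine Tendsto.congr' heq ?_
  rw [localForm]
  by_cases hu : ∃ v : C(K, ℝ), ⇑u =ᵐ[ν] ⇑v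
  · obtain ⟨v, hv⟩ := hu
    simp only [extend_eq _ hv]
    exact tendsto_scaledEnergy v
  · simp only [extend_eq_top _ hu]
    exact tendsto_const_nhds

end Gasket

namespace Gasket

/-! ### Harmonic functions and density of the domain -/

/-- Cells meet only at f_i(p_j) = f_j(p_i), so agreement there makes the glued function well
defined. It is continuous because K is a quotient of the compact disjoint union of three copies of
itself. -/
theorem exists_glue (g : Fin 3 → C(K, ℝ)) (h : ∀ i j, g i (p j) = g j (p i)) :
    ∃ u : C(K, ℝ), ∀ i x, u (f i x) = g i x := by
  have hwd : ∀ i j x y, f i x = f j y → g i x = g j y := by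
    intro i j x y hxy
    rcases eq_or_ne i j with rfl | hij
    · rw [f_injective i hxy]
    · obtain ⟨rfl, rfl⟩ := eq_p_of_f_eq_f hij hxy
      exact h i j
  choose i y hy using exists_f_eq
  have hu : ∀ k x, g (i (f k x)) (y (f k x)) = g k x := fun k x => hwd _ _ _ _ (hy _)
  have hq : Topology.IsQuotientMap fun q : Fin 3 × K => f q.1 q.2 := by
    have hc : Continuous fun q : Fin 3 × K => f q.1 q.2 :=
      continuous_prod_of_discrete_left.2 fun k => continuous_f k
    exact hc.isClosedMap.isQuotientMap hc fun x => ⟨(i x, y x), hy x⟩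
  refine ⟨⟨fun x => g (i x) (y x), hq.continuous_iff.2 ?_⟩, fun k x => hu k x⟩
  refine continuous_prod_of_discrete_left.2 fun k => ?_
  have : (fun x => ((fun x => g (i x) (y x)) ∘ fun q : Fin 3 × K => f q.1 q.2) (k, x)) = g k :=
    funext fun x => hu k x
  rw [this]
  exact (g k).continuous

/-- The barycentric coordinates as continuous functions on the gasket. -/
noncomputable def baryMap (j : Fin 3) : C(K, ℝ) :=
  ⟨fun x => bary j x, (continuous_bary j).comp continuous_subtype_val⟩

/-- The triples of continuous functions with the boundary values of the harmonic basis. -/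
def BoundaryTriple : Type :=
  {H : Fin 3 → C(K, ℝ) // ∀ j i, H j (p i) = if j = i then 1 else 0}

noncomputable instance : MetricSpace BoundaryTriple :=
  inferInstanceAs (MetricSpace {H : Fin 3 → C(K, ℝ) // ∀ j i, H j (p i) = if j = i then 1 else 0})

instance : Nonempty BoundaryTriple := ⟨⟨baryMap, fun j i => bary_corner j i⟩⟩

instance : CompleteSpace BoundaryTriple := by
  refine IsClosed.completeSpace_coe (s := {H : Fin 3 → C(K, ℝ) | ∀ j i, H j (p i) =
    if j = i then 1 else 0}) (hs := ?_)
  simp only [Set.ofPred_forall]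
  refine isClosed_iInter fun j => isClosed_iInter fun i => isClosed_eq ?_ continuous_const
  exact (continuous_eval_const (p i)).comp (continuous_apply j)

/-- The values on the cell `fᵢ(K)` of the triple obtained from `H` by the harmonic extension
rule. -/
noncomputable def harmonicCell (H : Fin 3 → C(K, ℝ)) (j i : Fin 3) : C(K, ℝ) :=
  if i = j then ContinuousMap.const K (2 / 5) + (3 / 5 : ℝ) • H j
  else ContinuousMap.const K (1 / 5) + (1 / 5 : ℝ) • (H j - H i)

/-- The 1/5–2/5 rule: for boundary values 1, 0, 0 the midpoints next to the value 1 receive 2/5 and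
the opposite one 1/5. -/
theorem harmonicCell_corner (H : BoundaryTriple) (j i k : Fin 3) :
    harmonicCell H.1 j i (p k) =
      if i = j then (if k = j then 1 else 2 / 5)
      else if k = j then 2 / 5 else if k = i then 0 else 1 / 5 := by
  have hH := H.2
  simp only [harmonicCell]
  fin_cases i <;> fin_cases j <;> fin_cases k <;> simp [hH] <;> norm_num

theorem exists_harmonicStep (H : BoundaryTriple) (j : Fin 3) :
    ∃ u : C(K, ℝ), ∀ i x, u (f i x) = harmonicCell H.1 j i x := by
  refine exists_glue _ fun i k => ?_
  rw [harmonicCell_corner, harmonicCell_corner]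
  fin_cases i <;> fin_cases j <;> fin_cases k <;> simp

/-- One step of the harmonic extension procedure. -/
noncomputable def harmonicStep (H : BoundaryTriple) : BoundaryTriple :=
  ⟨fun j => (exists_harmonicStep H j).choose, fun j i => by
    have h := (exists_harmonicStep H j).choose_spec i (p i)
    rw [f_p_self] at h
    rw [h, harmonicCell_corner]
    fin_cases i <;> fin_cases j <;> simp⟩

theorem harmonicStep_apply (H : BoundaryTriple) (j i : Fin 3) (x : K) :
    (harmonicStep H).1 j (f i x) = harmonicCell H.1 j i x :=
  (exists_harmonicStep H j).choose_spec i x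

/-- In the sup norm the cell at the own corner contracts by 3/5, and the other two by 1/5 + 1/5. -/
theorem contractingWith_harmonicStep : ContractingWith (3 / 5) harmonicStep := by
  constructor
  · rw [← NNReal.coe_lt_coe]
    norm_num
  · refine LipschitzWith.of_dist_le_mul fun H G => ?_
    have hHG : ∀ j x, |H.1 j x - G.1 j x| ≤ dist H G := fun j x => by
      rw [← Real.dist_eq]
      exact (ContinuousMap.dist_apply_le_dist x).trans (dist_le_pi_dist H.1 G.1 j)
    have h0 : 0 ≤ dist H G := dist_nonneg
    change dist (harmonicStep H).1 (harmonicStep G).1 ≤ _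
    have hc : ((3 / 5 : ℝ≥0) : ℝ) = 3 / 5 := by norm_num
    rw [hc]
    refine (dist_pi_le_iff (by positivity)).2 fun j =>
      (ContinuousMap.dist_le (by positivity)).2 fun x => ?_
    obtain ⟨i, y, rfl⟩ := exists_f_eq x
    rw [harmonicStep_apply, harmonicStep_apply, Real.dist_eq]
    have hj := abs_le.1 (hHG j y)
    have hi := abs_le.1 (hHG i y)
    unfold harmonicCell
    split_ifs <;>
      simp only [ContinuousMap.add_apply, ContinuousMap.const_apply, ContinuousMap.smul_apply,
        ContinuousMap.sub_apply, smul_eq_mul] <;>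
      rw [abs_le] <;> constructor <;> linarith [hj.1, hj.2, hi.1, hi.2]

/-- The harmonic functions with boundary values `1` at one corner and `0` at the others. -/
noncomputable def harmonic : Fin 3 → C(K, ℝ) :=
  (contractingWith_harmonicStep.fixedPoint harmonicStep).1

theorem harmonic_corner (j i : Fin 3) : harmonic j (p i) = if j = i then 1 else 0 :=
  (contractingWith_harmonicStep.fixedPoint harmonicStep).2 j i

theorem harmonic_f (j i : Fin 3) (x : K) : harmonic j (f i x) = harmonicCell harmonic j i x := by
  have h := contractingWith_harmonicStep.fixedPoint_isFixedPt
  unfold harmonic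
  rw [← harmonicStep_apply, h.eq]

/-- On every subcell the deviation of the sum from 1 is a fifth of its value on K, so its maximum
vanishes. -/
theorem sum_harmonic (x : K) : ∑ j, harmonic j x = 1 := by
  have hstep : ∀ i y, ∑ j, harmonic j (f i y) = 4 / 5 + 1 / 5 * ∑ j, harmonic j y := by
    intro i y
    simp only [harmonic_f, harmonicCell, Fin.sum_univ_three]
    fin_cases i <;> simp <;> ring
  have hc : Continuous fun x => |∑ j, harmonic j x - 1| := by fun_prop
  obtain ⟨z, -, hz⟩ := isCompact_univ.exists_isMaxOn Set.univ_nonempty hc.continuousOn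
  have hmax : ∀ y, |∑ j, harmonic j y - 1| ≤ |∑ j, harmonic j z - 1| := fun y =>
    isMaxOn_iff.1 hz y (Set.mem_univ _)
  clear hz
  obtain ⟨i, y, rfl⟩ := exists_f_eq z
  have h1 := hmax y
  have h2 := hmax x
  have e : ∑ j, harmonic j (f i y) - 1 = 1 / 5 * (∑ j, harmonic j y - 1) := by
    rw [hstep]
    ring
  rw [e, abs_mul, abs_of_pos (by norm_num : (0 : ℝ) < 1 / 5)] at h1 h2
  have h3 := abs_nonneg (∑ j, harmonic j y - 1)
  have h4 := abs_nonneg (∑ j, harmonic j x - 1)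
  exact sub_eq_zero.1 (abs_eq_zero.1 (by linarith))

theorem sum_cellSum {ι : Type*} [Fintype ι] (n : ℕ) (F : ι → K → ℝ) :
    ∑ i, cellSum n (F i) = ∑ w : Fin n → Fin 3, ∑ a : Fin 3, ∑ b : Fin 3,
      ∑ i, (F i (wordMap n w (p a)) - F i (wordMap n w (p b))) ^ 2 := by
  unfold cellSum
  rw [Finset.sum_comm]
  refine Finset.sum_congr rfl fun w _ => ?_
  rw [Finset.sum_comm]
  exact Finset.sum_congr rfl fun a _ => Finset.sum_comm

theorem sum_cellSum_eq {ι κ : Type*} [Fintype ι] [Fintype κ] (n : ℕ) (F : ι → K → ℝ)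
    (G : κ → K → ℝ) (c : ℝ)
    (h : ∀ x y, ∑ i, (F i x - F i y) ^ 2 = c * ∑ j, (G j x - G j y) ^ 2) :
    ∑ i, cellSum n (F i) = c * ∑ j, cellSum n (G j) := by
  rw [sum_cellSum, sum_cellSum]
  simp only [h, Finset.mul_sum]

/-- With d_j the increments of the three functions between two points and ∑ d_j = 0, the increments
on the subcells have total square 9/25 ∑ d_j² + 6/25 ∑ d_j² = 3/5 ∑ d_j². The identity holds for
arbitrary pairs of points, so it iterates. -/
theorem sum_cellSum_harmonic (n : ℕ) :
    ∑ j, cellSum n (harmonic j) = (3 / 5) ^ n * ∑ j, cellSum 0 (harmonic j) := by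
  induction n with
  | zero => simp
  | succ n ih =>
    rw [pow_succ', mul_assoc, ← ih]
    simp only [cellSum_succ]
    rw [← Fintype.sum_prod_type']
    refine sum_cellSum_eq n (fun q : Fin 3 × Fin 3 => harmonic q.1 ∘ f q.2)
      (fun j => harmonic j) _ fun x y => ?_
    rw [Fintype.sum_prod_type]
    have hx := sum_harmonic x
    have hy := sum_harmonic y
    simp only [Function.comp_apply, harmonic_f, harmonicCell, Fin.sum_univ_three] at hx hy ⊢
    simp only [Fin.isValue, Fin.reduceEq, if_true, if_false, ContinuousMap.add_apply,
      ContinuousMap.const_apply, ContinuousMap.smul_apply, ContinuousMap.sub_apply, smul_eq_mul]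
    have ex : harmonic 2 x = 1 - harmonic 0 x - harmonic 1 x := by linarith
    have ey : harmonic 2 y = 1 - harmonic 0 y - harmonic 1 y := by linarith
    rw [ex, ey]
    ring

/-- The functions with bounded renormalized level energies. -/
def HasFiniteEnergy (u : K → ℝ) : Prop := ∃ C : ℝ, ∀ n, (5 / 3) ^ n * cellSum n u ≤ C

theorem HasFiniteEnergy.localEnergy_lt_top {u : K → ℝ} (h : HasFiniteEnergy u) :
    localEnergy u < ⊤ := by
  obtain ⟨C, hC⟩ := h
  refine lt_of_le_of_lt ?_ (ENNReal.ofReal_lt_top (r := C))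
  exact le_of_tendsto' (tendsto_levelEnergy u) fun n => ENNReal.ofReal_le_ofReal (hC n)

theorem cellSum_add_le (n : ℕ) (u v : K → ℝ) :
    cellSum n (u + v) ≤ 2 * cellSum n u + 2 * cellSum n v := by
  simp only [cellSum, Finset.mul_sum, ← Finset.sum_add_distrib]
  gcongr with w _ i _ j _
  simp only [Pi.add_apply]
  generalize u (wordMap n w (p i)) = a
  generalize u (wordMap n w (p j)) = b
  generalize v (wordMap n w (p i)) = c
  generalize v (wordMap n w (p j)) = d
  nlinarith [sq_nonneg ((a - b) - (c - d))]

theorem cellSum_smul (n : ℕ) (c : ℝ) (u : K → ℝ) : cellSum n (c • u) = c ^ 2 * cellSum n u := by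
  simp only [cellSum, Finset.mul_sum, Pi.smul_apply, smul_eq_mul]
  simp only [← mul_sub, mul_pow]

theorem HasFiniteEnergy.add {u v : K → ℝ} (hu : HasFiniteEnergy u) (hv : HasFiniteEnergy v) :
    HasFiniteEnergy (u + v) := by
  obtain ⟨C, hC⟩ := hu
  obtain ⟨D, hD⟩ := hv
  refine ⟨2 * C + 2 * D, fun n => ?_⟩
  have h := mul_le_mul_of_nonneg_left (cellSum_add_le n u v)
    (by positivity : (0 : ℝ) ≤ (5 / 3) ^ n)
  linarith [hC n, hD n]

theorem HasFiniteEnergy.smul {u : K → ℝ} (hu : HasFiniteEnergy u) (c : ℝ) :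
    HasFiniteEnergy (c • u) := by
  obtain ⟨C, hC⟩ := hu
  refine ⟨c ^ 2 * C, fun n => ?_⟩
  rw [cellSum_smul, mul_left_comm]
  exact mul_le_mul_of_nonneg_left (hC n) (sq_nonneg c)

/-- The level-n energy is at most the level-(n+1) energy, which is the sum over the three subcells
of level-n energies. Hence gluing preserves finite energy. -/
theorem hasFiniteEnergy_of_comp_f {u : K → ℝ} (h : ∀ i, HasFiniteEnergy (u ∘ f i)) :
    HasFiniteEnergy u := by
  choose C hC using h
  refine ⟨5 / 3 * ∑ i, C i, fun n => ?_⟩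
  have h1 : (5 / 3 : ℝ) ^ n * cellSum n u ≤ (5 / 3) ^ n * (5 / 3 * cellSum (n + 1) u) :=
    mul_le_mul_of_nonneg_left (cellSum_le_succ n u) (by positivity)
  refine h1.trans ?_
  rw [cellSum_succ, mul_left_comm, Finset.mul_sum]
  gcongr with i _
  exact hC i n

theorem hasFiniteEnergy_harmonic (j : Fin 3) : HasFiniteEnergy (harmonic j) := by
  refine ⟨∑ j, cellSum 0 (harmonic j), fun n => ?_⟩
  have h1 : cellSum n (harmonic j) ≤ ∑ j, cellSum n (harmonic j) :=
    Finset.single_le_sum (f := fun j => cellSum n (harmonic j)) (fun _ _ => cellSum_nonneg _ _)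
      (Finset.mem_univ j)
  rw [sum_cellSum_harmonic] at h1
  calc _ ≤ (5 / 3 : ℝ) ^ n * ((3 / 5) ^ n * ∑ j, cellSum 0 (harmonic j)) :=
        mul_le_mul_of_nonneg_left h1 (by positivity)
    _ = _ := by
        rw [← mul_assoc, ← mul_pow]
        norm_num

/-- Piecewise harmonic interpolation at the level-n vertices. Matching the corner values is part of
the induction so that the pieces glue; a bound C on ∑ |h_j| replaces the maximum principle. -/
theorem exists_hasFiniteEnergy_near {C : ℝ} (hC : ∀ x, ∑ j, |harmonic j x| ≤ C) (n : ℕ)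
    (v : C(K, ℝ)) {ε : ℝ} (hv : ∀ x y, dist x y ≤ (1 / 2) ^ n → |v x - v y| ≤ ε) :
    ∃ u : C(K, ℝ), HasFiniteEnergy u ∧ (∀ i, u (p i) = v (p i)) ∧
      ∀ x, |u x - v x| ≤ C * ε := by
  induction n generalizing v with
  | zero =>
    refine ⟨v (p 0) • harmonic 0 + v (p 1) • harmonic 1 + v (p 2) • harmonic 2, ?_, ?_, ?_⟩
    · exact (((hasFiniteEnergy_harmonic 0).smul (v (p 0))).add
        ((hasFiniteEnergy_harmonic 1).smul (v (p 1)))).add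
        ((hasFiniteEnergy_harmonic 2).smul (v (p 2)))
    · intro i
      simp only [ContinuousMap.add_apply, ContinuousMap.smul_apply, harmonic_corner]
      fin_cases i <;> simp
    · intro x
      have hs := sum_harmonic x
      have e : (v (p 0) • harmonic 0 + v (p 1) • harmonic 1 + v (p 2) • harmonic 2) x - v x =
          ∑ j, harmonic j x * (v (p j) - v x) := by
        rw [Fin.sum_univ_three] at hs ⊢
        simp only [ContinuousMap.add_apply, ContinuousMap.smul_apply, smul_eq_mul]
        linear_combination (v x) * hs
      have hε : 0 ≤ ε := (abs_nonneg _).trans (hv x x (by simp))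
      rw [e]
      calc |∑ j, harmonic j x * (v (p j) - v x)|
          ≤ ∑ j, |harmonic j x * (v (p j) - v x)| := Finset.abs_sum_le_sum_abs _ _
        _ ≤ ∑ j, |harmonic j x| * ε := by
            gcongr with j _
            rw [abs_mul]
            exact mul_le_mul_of_nonneg_left (hv _ _ (by simpa using dist_le_one _ _))
              (abs_nonneg _)
        _ ≤ C * ε := by
            rw [← Finset.sum_mul]
            exact mul_le_mul_of_nonneg_right (hC x) hε
  | succ n ih =>
    have hi : ∀ i, ∃ u : C(K, ℝ), HasFiniteEnergy u ∧ (∀ k, u (p k) = v (f i (p k))) ∧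
        ∀ x, |u x - v (f i x)| ≤ C * ε := fun i =>
      ih (v.comp ⟨f i, continuous_f i⟩) fun x y hxy => hv _ _ <| by
        change dist (f i x) (f i y) ≤ _
        rw [dist_f, pow_succ]
        linarith
    choose g hg1 hg2 hg3 using hi
    obtain ⟨u, hu⟩ := exists_glue g fun i j => by rw [hg2, hg2, f_p_comm]
    refine ⟨u, hasFiniteEnergy_of_comp_f fun i => ?_, fun i => ?_, fun x => ?_⟩
    · have : ⇑u ∘ f i = g i := funext fun x => hu i x
      rw [this]
      exact hg1 i
    · have := hu i (p i)
      rw [hg2, f_p_self] at this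
      exact this
    · obtain ⟨i, y, rfl⟩ := exists_f_eq x
      rw [hu]
      exact hg3 i y

theorem exists_localEnergy_lt_top_near (v : C(K, ℝ)) {ε : ℝ} (hε : 0 < ε) :
    ∃ u : C(K, ℝ), localEnergy u < ⊤ ∧ dist u v ≤ ε := by
  have hc : Continuous fun x => ∑ j, |harmonic j x| := by fun_prop
  obtain ⟨C, hC⟩ := isCompact_univ.exists_bound_of_continuousOn hc.continuousOn
  have hC1 : ∀ x, ∑ j, |harmonic j x| ≤ max C 1 := fun x =>
    (le_abs_self _).trans ((hC x (Set.mem_univ _)).trans (le_max_left _ _))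
  have hpos : 0 < max C 1 := lt_max_of_lt_right one_pos
  obtain ⟨δ, hδ, hunif⟩ := Metric.uniformContinuous_iff.1
    (CompactSpace.uniformContinuous_of_continuous v.continuous) (ε / max C 1) (by positivity)
  obtain ⟨n, hn⟩ := exists_pow_lt_of_lt_one hδ (by norm_num : (1 / 2 : ℝ) < 1)
  obtain ⟨u, hu, -, huv⟩ := exists_hasFiniteEnergy_near hC1 n v (ε := ε / max C 1)
    fun x y hxy => by
      rw [← Real.dist_eq]
      exact (hunif (hxy.trans_lt hn)).le
  refine ⟨u, hu.localEnergy_lt_top, (ContinuousMap.dist_le hε.le).2 fun x => ?_⟩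
  rw [Real.dist_eq]
  refine (huv x).trans (le_of_eq ?_)
  field_simp

end Gasket

namespace Gasket

/-! ### Modulus of continuity of functions of finite energy -/

theorem cellSum_comp_wordMap_le (n m : ℕ) (w : Fin n → Fin 3) (u : K → ℝ) :
    cellSum m (u ∘ wordMap n w) ≤ cellSum (n + m) u := by
  rw [← sum_cellSum_comp_wordMap n m u]
  exact Finset.single_le_sum (f := fun w => cellSum m (u ∘ wordMap n w))
    (fun _ _ => cellSum_nonneg _ _) (Finset.mem_univ w)

/-- Chaining along the letters of w: the step at depth m is at most the square root of the
corresponding cell sum, hence at most A r^m. -/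
theorem abs_wordMap_sub_corner_le (N : ℕ) {u : K → ℝ} {A r : ℝ} (hA : 0 ≤ A) (hr : 0 ≤ r)
    (h : ∀ m, cellSum (m + 1) u ≤ (A * r ^ m) ^ 2) (w : Fin N → Fin 3) (i : Fin 3) :
    |u (wordMap N w (p i)) - u (p i)| ≤ A * ∑ m ∈ Finset.range N, r ^ m := by
  induction N generalizing u A with
  | zero => simp [wordMap]
  | succ N ih =>
    have h1 : |u (f (w 0) (p i)) - u (p i)| ≤ A := by
      refine abs_le_of_sq_le_sq ?_ hA
      have h0 := h 0
      rw [pow_zero, mul_one] at h0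
      exact (Finset.single_le_sum (f := fun k => (u (f k (p i)) - u (p i)) ^ 2)
        (fun _ _ => sq_nonneg _) (Finset.mem_univ (w 0))).trans ((sum_sub_corner_le u i).trans h0)
    have h2 : |(u ∘ f (w 0)) (wordMap N (Fin.tail w) (p i)) - (u ∘ f (w 0)) (p i)| ≤
        A * r * ∑ m ∈ Finset.range N, r ^ m := by
      refine ih (mul_nonneg hA hr) (fun m => ?_) _
      have h3 : cellSum (m + 1) (u ∘ f (w 0)) ≤ cellSum (m + 1 + 1) u := by
        rw [cellSum_succ (m + 1) u]
        exact Finset.single_le_sum (f := fun k => cellSum (m + 1) (u ∘ f k))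
          (fun _ _ => cellSum_nonneg _ _) (Finset.mem_univ (w 0))
      refine h3.trans ((h (m + 1)).trans (le_of_eq ?_))
      ring
    have h4 : A * ∑ m ∈ Finset.range (N + 1), r ^ m =
        A * r * ∑ m ∈ Finset.range N, r ^ m + A := by
      rw [Finset.sum_range_succ', Finset.mul_sum, mul_add, Finset.mul_sum]
      simp [pow_succ', mul_assoc]
    rw [h4]
    refine (abs_sub_le _ (u (f (w 0) (p i))) _).trans (add_le_add h2 h1)

theorem abs_sub_corner_le {u : K → ℝ} (hu : Continuous u) {A r : ℝ} (hA : 0 ≤ A) (hr : 0 ≤ r)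
    (hr1 : r < 1) (h : ∀ m, cellSum (m + 1) u ≤ (A * r ^ m) ^ 2) (x : K) (i : Fin 3) :
    |u x - u (p i)| ≤ A * (1 - r)⁻¹ := by
  refine le_of_forall_pos_le_add fun ε hε => ?_
  obtain ⟨δ, hδ, hc⟩ := Metric.continuousAt_iff.1 (hu.continuousAt (x := x)) ε hε
  obtain ⟨N, hN⟩ := exists_pow_lt_of_lt_one hδ (by norm_num : (1 / 2 : ℝ) < 1)
  obtain ⟨w, y, rfl⟩ := exists_wordMap_eq N x
  have h1 : dist (wordMap N w (p i)) (wordMap N w y) < δ := by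
    refine lt_of_le_of_lt ?_ hN
    rw [dist_wordMap, one_div, inv_pow, div_eq_mul_inv]
    exact mul_le_of_le_one_left (by positivity) (dist_le_one _ _)
  have h2 := hc h1
  rw [Real.dist_eq, abs_sub_comm] at h2
  have h3 := abs_wordMap_sub_corner_le N hA hr h w i
  have h4 : ∑ m ∈ Finset.range N, r ^ m ≤ (1 - r)⁻¹ := by
    rw [← tsum_geometric_of_lt_one hr hr1]
    exact (summable_geometric_of_lt_one hr hr1).sum_le_tsum _ fun _ _ => by positivity
  have h5 := abs_sub_le (u (wordMap N w y)) (u (wordMap N w (p i))) (u (p i))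
  linarith [mul_le_mul_of_nonneg_left h4 hA]

/-- Both points are chained to the vertex shared by their level-n cells; restricting u to such a
cell replaces A by A rⁿ. -/
theorem abs_sub_le_of_cellSum_le {u : K → ℝ} (hu : Continuous u) {A r : ℝ} (hA : 0 ≤ A)
    (hr : 0 ≤ r) (hr1 : r < 1) (h : ∀ m, cellSum (m + 1) u ≤ (A * r ^ m) ^ 2) (n : ℕ) {x y : K}
    (hxy : dist x y ≤ (1 / 2) ^ (n + 1)) :
    |u x - u y| ≤ 2 * A * (1 - r)⁻¹ * r ^ n := by
  have key : ∀ (w : Fin n → Fin 3) (z : K) (i : Fin 3),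
      |u (wordMap n w z) - u (wordMap n w (p i))| ≤ A * r ^ n * (1 - r)⁻¹ := by
    intro w z i
    refine abs_sub_corner_le (u := u ∘ wordMap n w) (hu.comp (continuous_wordMap n w))
      (by positivity) hr hr1 (fun m => ?_) z i
    refine (cellSum_comp_wordMap_le n (m + 1) w u).trans ((h (n + m)).trans (le_of_eq ?_))
    rw [pow_add, mul_assoc]
  obtain ⟨w, a, rfl⟩ := exists_wordMap_eq n x
  obtain ⟨w', b, rfl⟩ := exists_wordMap_eq n y
  obtain ⟨i, j, hij⟩ := adj_of_dist_le hxy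
  have h1 := key w a i
  have h2 := key w' b j
  rw [← hij, abs_sub_comm] at h2
  have h3 := abs_sub_le (u (wordMap n w a)) (u (wordMap n w (p i))) (u (wordMap n w' b))
  linarith

/-- Morrey-type embedding: each term of E_β is at most c, so cell sums decay like t^(-m) and r =
t^(-1/2) < 1. Both constants depend only on β and c, which provides the equicontinuity used for
compactness. -/
theorem exists_modulus {β : ℝ} (hβ : α < β) (c : ℝ≥0) :
    ∃ D r : ℝ, 0 ≤ r ∧ r < 1 ∧ ∀ u : K → ℝ, Continuous u → discreteEnergy β u ≤ c →
      (∀ x y, |u x - u y| ≤ D) ∧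
      ∀ n x y, dist x y ≤ (1 / 2) ^ (n + 1) → |u x - u y| ≤ D * r ^ n := by
  have ht : (1 : ℝ) < ratio β := one_lt_ratio hβ
  set t : ℝ := (ratio β : ℝ) with htdef
  have hr0 : 0 ≤ √(t⁻¹) := Real.sqrt_nonneg _
  have hr2 : √(t⁻¹) ^ 2 = t⁻¹ := Real.sq_sqrt (by positivity)
  have hr1 : √(t⁻¹) < 1 := by
    rw [Real.sqrt_lt' one_pos, one_pow]
    exact inv_lt_one_of_one_lt₀ ht
  have hinv : 0 < (1 - √(t⁻¹))⁻¹ := inv_pos.2 (by linarith)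
  refine ⟨2 * √c * (1 - √(t⁻¹))⁻¹, √(t⁻¹), hr0, hr1, fun u hu hE => ?_⟩
  have hcell : ∀ m, cellSum (m + 1) u ≤ (√c * √(t⁻¹) ^ m) ^ 2 := by
    intro m
    rw [discreteEnergy_eq] at hE
    have h1 := (ENNReal.le_tsum m).trans hE
    rw [← ENNReal.ofReal_coe_nnreal, ← ENNReal.ofReal_pow (by positivity),
      ← ENNReal.ofReal_mul (by positivity), ← ENNReal.ofReal_coe_nnreal,
      ENNReal.ofReal_le_ofReal_iff (by positivity), ← htdef, mul_comm,
      ← le_div_iff₀ (by positivity)] at h1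
    rw [mul_pow, Real.sq_sqrt (by positivity), ← pow_mul, mul_comm m 2, pow_mul, hr2, inv_pow,
      ← div_eq_mul_inv]
    refine h1.trans ?_
    gcongr
    · exact ht.le
    · omega
  refine ⟨fun x y => ?_, fun n x y hxy =>
    abs_sub_le_of_cellSum_le hu (by positivity) hr0 hr1 hcell n hxy⟩
  have h1 := abs_sub_corner_le hu (Real.sqrt_nonneg _) hr0 hr1 hcell x 0
  have h2 := abs_sub_corner_le hu (Real.sqrt_nonneg _) hr0 hr1 hcell y 0
  rw [abs_sub_comm] at h2
  have h3 := abs_sub_le (u x) (u (p 0)) (u y)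
  linarith

theorem isCompact_modulus (D r M : ℝ) (hr : 0 ≤ r) (hr1 : r < 1) :
    IsCompact {u : C(K, ℝ) | (∀ n x y, dist x y ≤ (1 / 2) ^ (n + 1) → |u x - u y| ≤ D * r ^ n) ∧
      ∀ x, |u x| ≤ M} := by
  have hω : Tendsto (fun n : ℕ => D * r ^ n) atTop (𝓝 0) := by
    simpa using (tendsto_pow_atTop_nhds_zero_of_lt_one hr hr1).const_mul D
  have hδ : ∀ ε > 0, ∃ δ > 0, ∀ g : K → ℝ,
      (∀ n x y, dist x y ≤ (1 / 2) ^ (n + 1) → |g x - g y| ≤ D * r ^ n) →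
      ∀ x y, dist x y < δ → |g x - g y| < ε := by
    intro ε hε
    obtain ⟨n, hn⟩ := ((tendsto_order.1 hω).2 ε hε).exists
    exact ⟨(1 / 2) ^ (n + 1), by positivity, fun g hg x y hxy => (hg n x y hxy.le).trans_lt hn⟩
  refine ArzelaAscoli.isCompact_of_equicontinuous _ ?_ ?_
  -- The modulus forces continuity, so the image in the product space is cut out by closed pointwise
  -- conditions alone.
  · have himage : ContinuousMap.toFun '' {u : C(K, ℝ) |
        (∀ n x y, dist x y ≤ (1 / 2) ^ (n + 1) → |u x - u y| ≤ D * r ^ n) ∧ ∀ x, |u x| ≤ M} =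
        {g : K → ℝ | (∀ n x y, dist x y ≤ (1 / 2) ^ (n + 1) → |g x - g y| ≤ D * r ^ n) ∧
          ∀ x, |g x| ≤ M} := by
      ext g
      constructor
      · rintro ⟨u, hu, rfl⟩
        exact hu
      · intro hg
        have hc : Continuous g := Metric.continuous_iff.2 fun y ε hε => by
          obtain ⟨δ, hpos, h⟩ := hδ ε hε
          exact ⟨δ, hpos, fun x hxy => h g hg.1 x y hxy⟩
        exact ⟨⟨g, hc⟩, hg, rfl⟩
    rw [himage]
    refine (isCompact_univ_pi fun _ : K => isCompact_Icc (a := -M) (b := M)).of_isClosed_subset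
      ?_ fun g hg x _ => abs_le.1 (hg.2 x)
    simp only [Set.ofPred_and, Set.ofPred_forall]
    refine IsClosed.inter ?_ ?_
    · refine isClosed_iInter fun n => isClosed_iInter fun x => isClosed_iInter fun y =>
        isClosed_iInter fun _ => isClosed_le ?_ continuous_const
      fun_prop
    · refine isClosed_iInter fun x => isClosed_le ?_ continuous_const
      fun_prop
  · refine fun x => Metric.equicontinuousAt_iff.2 fun ε hε => ?_
    obtain ⟨δ, hpos, h⟩ := hδ ε hε
    refine ⟨δ, hpos, fun y hy u => ?_⟩
    rw [dist_comm]
    exact h u.1 u.2.1 y x hy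

/-! ### Weak lower semicontinuity -/

/-- The embedding of `C(K)` into `L²(K; ν)`. -/
noncomputable def toL2 : C(K, ℝ) →L[ℝ] L2 := ContinuousMap.toLp 2 ν ℝ

theorem coeFn_toL2 (v : C(K, ℝ)) : ⇑(toL2 v) =ᵐ[ν] ⇑v := ContinuousMap.coeFn_toLp ν v

theorem toL2_injective : Function.Injective toL2 := ContinuousMap.toLp_injective ν

theorem denseRange_toL2 : DenseRange toL2 := ContinuousMap.toLp_denseRange _ _ _ (by simp)

theorem extend_toL2 (E : (K → ℝ) → ℝ≥0∞) (v : C(K, ℝ)) : extend E (toL2 v) = E v :=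
  extend_eq E (coeFn_toL2 v)

theorem exists_toL2_eq {E : (K → ℝ) → ℝ≥0∞} {u : L2} (h : extend E u < ⊤) :
    ∃ v : C(K, ℝ), toL2 v = u := by
  obtain ⟨v, hv, -⟩ := exists_of_extend_lt_top h
  exact ⟨v, Lp.ext ((coeFn_toL2 v).trans hv.symm)⟩

theorem inner_toL2_one (u : C(K, ℝ)) : inner ℝ (toL2 u) (toL2 1) = ∫ x, u x ∂ν := by
  rw [toL2, ContinuousMap.inner_toLp]
  simp

theorem WeaklyConverges.comp_tendsto {H : Type*} [NormedAddCommGroup H] [InnerProductSpace ℝ H]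
    {u : ℕ → H} {v : H} (h : WeaklyConverges u v) {φ : ℕ → ℕ} (hφ : Tendsto φ atTop atTop) :
    WeaklyConverges (u ∘ φ) v := fun w => (h w).comp hφ

theorem weaklyConverges_of_tendsto {H : Type*} [NormedAddCommGroup H] [InnerProductSpace ℝ H]
    {u : ℕ → H} {v : H} (h : Tendsto u atTop (𝓝 v)) : WeaklyConverges u v := fun _ =>
  h.inner tendsto_const_nhds

theorem WeaklyConverges.unique {H : Type*} [NormedAddCommGroup H] [InnerProductSpace ℝ H]
    {u : ℕ → H} {v v' : H} (h : WeaklyConverges u v) (h' : WeaklyConverges u v') : v = v' :=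
  ext_inner_right ℝ fun w => tendsto_nhds_unique (h w) (h' w)

theorem discreteEnergy_le_of_tendsto (β : ℝ) {s : ℕ → C(K, ℝ)} {v : C(K, ℝ)} {c : ℝ≥0∞}
    (hs : Tendsto s atTop (𝓝 v)) (hc : ∀ n, discreteEnergy β (s n) ≤ c) :
    discreteEnergy β v ≤ c := by
  have hpt : ∀ x, Tendsto (fun n => s n x) atTop (𝓝 (v x)) := fun x =>
    ((continuous_eval_const x).tendsto v).comp hs
  have hcell : ∀ k, Tendsto (fun n => cellSum k (s n)) atTop (𝓝 (cellSum k v)) := fun k =>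
    tendsto_finsetSum _ fun w _ => tendsto_finsetSum _ fun i _ => tendsto_finsetSum _ fun j _ =>
      ((hpt _).sub (hpt _)).pow 2
  rw [discreteEnergy, ENNReal.tsum_eq_iSup_sum]
  refine iSup_le fun t => ?_
  have ht := tendsto_finsetSum t fun k _ => ENNReal.tendsto_ofReal
    ((hcell (k + 1)).const_mul ((2 : ℝ) ^ ((β - α) * ((k + 1 : ℕ) : ℝ))))
  exact le_of_tendsto' ht fun n => (ENNReal.sum_le_tsum t).trans (hc n)

/-- An energy bound makes the continuous versions equicontinuous; a bound on their means makes them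
bounded, and compactness then upgrades weak to uniform convergence along a subsequence. -/
theorem discreteEnergy_lsc {β : ℝ} (hβ : α < β) {s : ℕ → L2} {v : L2} {c : ℝ≥0}
    (hs : WeaklyConverges s v) (hc : ∀ n, extend (discreteEnergy β) (s n) ≤ c) :
    extend (discreteEnergy β) v ≤ c := by
  obtain ⟨D, r, hr, hr1, hmod⟩ := exists_modulus hβ c
  have hex : ∀ n, ∃ u : C(K, ℝ), toL2 u = s n := fun n =>
    exists_toL2_eq ((hc n).trans_lt ENNReal.coe_lt_top)
  choose u hu using hex
  have hE : ∀ n, discreteEnergy β (u n) ≤ c := fun n => by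
    rw [← extend_toL2 (discreteEnergy β), hu]
    exact hc n
  -- Testing weak convergence against the constant 1 shows that the means converge, hence are
  -- bounded.
  have hint := hs (toL2 1)
  simp only [← hu, inner_toL2_one] at hint
  obtain ⟨B, hB⟩ := (Metric.isBounded_range_of_tendsto _ hint).exists_norm_le
  have hbdd : ∀ n x, |u n x| ≤ D + B := by
    intro n x
    have h1 : ‖∫ y, (u n x - u n y) ∂ν‖ ≤ D := by
      have := norm_integral_le_of_norm_le_const (μ := ν) (f := fun y => u n x - u n y) (C := D)
        (ae_of_all _ fun y => (hmod _ (u n).continuous (hE n)).1 x y)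
      simpa using this
    rw [integral_sub (integrable_const _) (integrable_of_continuous (u n).continuous)] at h1
    simp only [integral_const, probReal_univ, smul_eq_mul, one_mul, Real.norm_eq_abs] at h1
    have h2 : |∫ y, u n y ∂ν| ≤ B := hB _ ⟨n, rfl⟩
    have h3 := abs_add_le (u n x - ∫ y, u n y ∂ν) (∫ y, u n y ∂ν)
    rw [sub_add_cancel] at h3
    linarith
  obtain ⟨w, -, φ, hφ, hw⟩ := (isCompact_modulus D r (D + B) hr hr1).tendsto_subseq
    (x := u) fun n => ⟨(hmod _ (u n).continuous (hE n)).2, hbdd n⟩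
  have hv : v = toL2 w := by
    refine (hs.comp_tendsto hφ.tendsto_atTop).unique (weaklyConverges_of_tendsto ?_)
    have := (toL2.continuous.tendsto w).comp hw
    refine this.congr fun n => ?_
    simp [hu]
  rw [hv, extend_toL2]
  exact discreteEnergy_le_of_tendsto β hw fun n => hE (φ n)

theorem scaledForm_lsc {β : ℝ} (hβ : α < β) (hβ' : β < βstar) {s : ℕ → L2} {v : L2} {c : ℝ≥0}
    (hs : WeaklyConverges s v) (hc : ∀ n, scaledForm β (s n) ≤ c) : scaledForm β v ≤ c := by
  have h0 : ENNReal.ofReal (1 - (5 : ℝ)⁻¹ * (2 : ℝ) ^ β) ≠ 0 := by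
    rw [ofReal_one_sub_decay]
    exact one_sub_decay_ne_zero hβ'
  have hd : ((c : ℝ≥0∞) / ENNReal.ofReal (1 - (5 : ℝ)⁻¹ * (2 : ℝ) ^ β)) ≠ ⊤ :=
    ENNReal.div_ne_top ENNReal.coe_ne_top h0
  unfold scaledForm at hc ⊢
  simp only [mul_comm (ENNReal.ofReal (1 - (5 : ℝ)⁻¹ * (2 : ℝ) ^ β)),
    ← ENNReal.le_div_iff_mul_le (Or.inl h0) (Or.inl ENNReal.ofReal_ne_top)] at hc ⊢
  rw [← ENNReal.coe_toNNReal hd] at hc ⊢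
  exact discreteEnergy_lsc hβ hs hc

/-- Inherited from the forms with β < β*, which lie below the local form and converge to it. -/
theorem localForm_lsc {s : ℕ → L2} {v : L2} {c : ℝ≥0} (hs : WeaklyConverges s v)
    (hc : ∀ n, localForm (s n) ≤ c) : localForm v ≤ c := by
  have hlt : α < βstar :=
    div_lt_div_of_pos_right (Real.log_lt_log (by norm_num) (by norm_num))
      (Real.log_pos (by norm_num))
  refine le_of_tendsto (tendsto_scaledForm v) ?_
  filter_upwards [Ioo_mem_nhdsLT hlt] with β hβ
  exact scaledForm_lsc hβ.1 hβ.2 hs fun n => (scaledForm_le_localForm hβ.2 _).trans (hc n)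

end Gasket

namespace Gasket

/-! ### Closedness of the forms -/

theorem extend_lt_top_iff {E : (K → ℝ) → ℝ≥0∞} {u : L2} :
    extend E u < ⊤ ↔ ∃ v : C(K, ℝ), E v < ⊤ ∧ toL2 v = u := by
  constructor
  · intro h
    obtain ⟨v, rfl⟩ := exists_toL2_eq h
    exact ⟨v, by rwa [extend_toL2] at h, rfl⟩
  · rintro ⟨v, hv, rfl⟩
    rwa [extend_toL2]

section ClosedForm

variable {E : (K → ℝ) → ℝ≥0∞} {Q : ℕ → C(K, ℝ) →ₗ[ℝ] C(K, ℝ) →ₗ[ℝ] ℝ}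

theorem tendsto_toReal_energy (hnonneg : ∀ n u, 0 ≤ Q n u u)
    (hlim : ∀ u, Tendsto (fun n => ENNReal.ofReal (Q n u u)) atTop (𝓝 (E u))) {u : C(K, ℝ)}
    (hu : E u < ⊤) : Tendsto (fun n => Q n u u) atTop (𝓝 (E u).toReal) := by
  have h := (ENNReal.tendsto_toReal hu.ne).comp (hlim u)
  refine h.congr fun n => ?_
  exact ENNReal.toReal_ofReal (hnonneg n u)

/-- The continuous functions on which a limit of forms is finite. -/
def finiteEnergy (hnonneg : ∀ n u, 0 ≤ Q n u u)
    (hlim : ∀ u, Tendsto (fun n => ENNReal.ofReal (Q n u u)) atTop (𝓝 (E u))) :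
    Submodule ℝ C(K, ℝ) where
  carrier := {u | E u < ⊤}
  add_mem' {u v} hu hv := by
    have h : E (u + v : C(K, ℝ)) ≤ 2 * E u + 2 * E v := by
      refine le_of_tendsto_of_tendsto' (hlim (u + v))
        ((ENNReal.Tendsto.const_mul (hlim u) (Or.inr (by simp))).add
          (ENNReal.Tendsto.const_mul (hlim v) (Or.inr (by simp)))) fun n => ?_
      have hle : Q n (u + v) (u + v) ≤ 2 * Q n u u + 2 * Q n v v := by
        have := hnonneg n (u - v)
        simp only [map_add, map_sub, LinearMap.add_apply, LinearMap.sub_apply] at this ⊢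
        linarith
      refine (ENNReal.ofReal_le_ofReal hle).trans (ENNReal.ofReal_add_le.trans (le_of_eq ?_))
      rw [ENNReal.ofReal_mul zero_le_two, ENNReal.ofReal_mul zero_le_two, ENNReal.ofReal_ofNat]
    exact h.trans_lt (ENNReal.add_lt_top.2 ⟨ENNReal.mul_lt_top (by simp) hu,
      ENNReal.mul_lt_top (by simp) hv⟩)
  zero_mem' := by
    have h := hlim 0
    simp only [map_zero, ENNReal.ofReal_zero] at h
    have h0 : E (0 : C(K, ℝ)) = 0 := tendsto_nhds_unique h tendsto_const_nhds
    change E (0 : C(K, ℝ)) < ⊤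
    rw [h0]
    exact ENNReal.zero_lt_top
  smul_mem' c u hu := by
    have h : E (c • u : C(K, ℝ)) ≤ ENNReal.ofReal (c ^ 2) * E u := by
      refine le_of_tendsto_of_tendsto' (hlim (c • u))
        (ENNReal.Tendsto.const_mul (hlim u) (Or.inr (by simp))) fun n => ?_
      rw [← ENNReal.ofReal_mul (sq_nonneg _)]
      refine ENNReal.ofReal_le_ofReal (le_of_eq ?_)
      simp only [map_smul, LinearMap.smul_apply, smul_eq_mul]
      ring
    exact h.trans_lt (ENNReal.mul_lt_top (by simp) hu)

/-- Polarization: the values at u + v and u - v converge to finite limits. -/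
theorem exists_tendsto_polar (hsymm : ∀ n u v, Q n u v = Q n v u)
    (hnonneg : ∀ n u, 0 ≤ Q n u u)
    (hlim : ∀ u, Tendsto (fun n => ENNReal.ofReal (Q n u u)) atTop (𝓝 (E u)))
    (u v : finiteEnergy hnonneg hlim) :
    ∃ b : ℝ, Tendsto (fun n => Q n u v) atTop (𝓝 b) := by
  have h1 := tendsto_toReal_energy hnonneg hlim (u + v).2
  have h2 := tendsto_toReal_energy hnonneg hlim (u - v).2
  refine ⟨_, ((h1.sub h2).div_const 4).congr fun n => ?_⟩
  have := hsymm n u v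
  simp only [Submodule.coe_add, Submodule.coe_sub, map_add, map_sub, LinearMap.add_apply,
    LinearMap.sub_apply]
  linarith

theorem exists_limit_form (hsymm : ∀ n u v, Q n u v = Q n v u)
    (hnonneg : ∀ n u, 0 ≤ Q n u u)
    (hlim : ∀ u, Tendsto (fun n => ENNReal.ofReal (Q n u u)) atTop (𝓝 (E u))) :
    ∃ (F : Submodule ℝ C(K, ℝ)) (B : F →ₗ[ℝ] F →ₗ[ℝ] ℝ), (∀ u, u ∈ F ↔ E u < ⊤) ∧
      (∀ u v, B u v = B v u) ∧ ∀ u, B u u = (E (u : C(K, ℝ))).toReal := by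
  choose b hb using exists_tendsto_polar hsymm hnonneg hlim
  refine ⟨finiteEnergy hnonneg hlim, LinearMap.mk₂ ℝ b (fun u u' v => ?_) (fun c u v => ?_)
    (fun u v v' => ?_) (fun c u v => ?_), fun u => Iff.rfl, fun u v => ?_, fun u => ?_⟩
  · refine tendsto_nhds_unique (hb _ _) (((hb u v).add (hb u' v)).congr fun n => ?_)
    simp
  · refine tendsto_nhds_unique (hb _ _) (((hb u v).const_mul c).congr fun n => ?_)
    simp
  · refine tendsto_nhds_unique (hb _ _) (((hb u v).add (hb u v')).congr fun n => ?_)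
    simp
  · refine tendsto_nhds_unique (hb _ _) (((hb u v).const_mul c).congr fun n => ?_)
    simp
  · exact tendsto_nhds_unique (hb u v) ((hb v u).congr fun n => hsymm n _ _)
  · exact tendsto_nhds_unique (hb u u) (tendsto_toReal_energy hnonneg hlim u.2)

theorem exists_limit_form_L2 (hsymm : ∀ n u v, Q n u v = Q n v u)
    (hnonneg : ∀ n u, 0 ≤ Q n u u)
    (hlim : ∀ u, Tendsto (fun n => ENNReal.ofReal (Q n u u)) atTop (𝓝 (E u))) :
    ∃ (D : Submodule ℝ L2) (B : D →ₗ[ℝ] D →ₗ[ℝ] ℝ), (∀ u, u ∈ D ↔ extend E u < ⊤) ∧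
      (∀ u v, B u v = B v u) ∧ ∀ u, B u u = (extend E (u : L2)).toReal := by
  obtain ⟨F, B, hF, hBsymm, hB⟩ := exists_limit_form hsymm hnonneg hlim
  let e : F ≃ₗ[ℝ] F.map (toL2 : C(K, ℝ) →ₗ[ℝ] L2) :=
    Submodule.equivMapOfInjective _ toL2_injective F
  have he : ∀ u, toL2 (e.symm u : C(K, ℝ)) = u := fun u => by
    have h := Submodule.coe_equivMapOfInjective_apply (toL2 : C(K, ℝ) →ₗ[ℝ] L2) toL2_injective F
      (e.symm u)
    have h' : Submodule.equivMapOfInjective (toL2 : C(K, ℝ) →ₗ[ℝ] L2) toL2_injective F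
      (e.symm u) = u := e.apply_symm_apply u
    rw [h'] at h
    exact h.symm
  refine ⟨F.map (toL2 : C(K, ℝ) →ₗ[ℝ] L2), B.compl₁₂ e.symm.toLinearMap e.symm.toLinearMap,
    fun u => ?_, fun u v => ?_, fun u => ?_⟩
  · rw [extend_lt_top_iff, Submodule.mem_map]
    simp only [hF]
    rfl
  · exact hBsymm _ _
  · rw [LinearMap.compl₁₂_apply, LinearEquiv.coe_coe, hB, ← extend_toL2 E, he]

/-- A limit of non-negative quadratic forms is quadratic on its finiteness domain. Weak lower
semicontinuity then upgrades L²-limits of form-Cauchy sequences to limits in the form norm. -/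
theorem isClosedForm_extend (hsymm : ∀ n u v, Q n u v = Q n v u)
    (hnonneg : ∀ n u, 0 ≤ Q n u u)
    (hlim : ∀ u, Tendsto (fun n => ENNReal.ofReal (Q n u u)) atTop (𝓝 (E u)))
    (hdense : ∀ (v : C(K, ℝ)) (ε : ℝ), 0 < ε → ∃ u : C(K, ℝ), E u < ⊤ ∧ dist u v ≤ ε)
    (hlsc : ∀ (s : ℕ → L2) (v : L2) (c : ℝ≥0), WeaklyConverges s v →
      (∀ n, extend E (s n) ≤ c) → extend E v ≤ c) :
    IsClosedForm (extend E) := by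
  obtain ⟨D, B, hD, hBsymm, hB⟩ := exists_limit_form_L2 hsymm hnonneg hlim
  have hpos : ∀ u, 0 ≤ B u u := fun u => by
    rw [hB]
    exact ENNReal.toReal_nonneg
  have hval : ∀ u : D, extend E u = ENNReal.ofReal (B u u) := fun u => by
    rw [hB, ENNReal.ofReal_toReal ((hD _).1 u.2).ne]
  refine ⟨D, B, ?_, hBsymm, hpos, hval, fun u hu => not_lt_top_iff.1 fun h => hu ((hD u).2 h),
    fun s hs => ?_⟩
  · have hF : Dense {u : C(K, ℝ) | E u < ⊤} := fun v => Metric.mem_closure_iff.2 fun ε hε => by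
      obtain ⟨u, hu, huv⟩ := hdense v (ε / 2) (by positivity)
      exact ⟨u, hu, by rw [dist_comm]; linarith⟩
    refine (denseRange_toL2.dense_image toL2.continuous hF).mono ?_
    rintro _ ⟨u, hu, rfl⟩
    exact (hD _).2 (by rwa [extend_toL2])
  · have hcauchy : CauchySeq fun n => (s n : L2) := by
      refine Metric.cauchySeq_iff.2 fun ε hε => ?_
      obtain ⟨N, hN⟩ := hs (ε ^ 2) (by positivity)
      refine ⟨N, fun m hm n hn => ?_⟩
      have h := hN m hm n hn
      have h2 := hpos (s m - s n)
      rw [dist_eq_norm]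
      refine lt_of_pow_lt_pow_left₀ 2 hε.le ?_
      rw [Submodule.coe_sub] at h
      linarith
    obtain ⟨v, hv⟩ := cauchySeq_tendsto_of_complete hcauchy
    have hlim : ∀ ε > 0, ∃ N, ∀ n ≥ N, extend E ((s n : L2) - v) ≤ ENNReal.ofReal ε := by
      intro ε hε
      obtain ⟨N, hN⟩ := hs ε hε
      refine ⟨N, fun n hn => ?_⟩
      -- With n fixed, the differences s_n - s_{m+N} have energy below ε and tend to s_n - v as m →
      -- ∞.
      refine hlsc (fun m => (s n : L2) - s (m + N)) _ ε.toNNReal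
        (weaklyConverges_of_tendsto (((tendsto_add_atTop_iff_nat N).2 hv).const_sub _))
        fun m => ?_
      rw [← Submodule.coe_sub, hval]
      refine ENNReal.ofReal_le_ofReal ?_
      have := hN n hn (m + N) (Nat.le_add_left _ _)
      nlinarith [sq_nonneg ‖((s n - s (m + N) : D) : L2)‖]
    have hvD : v ∈ D := by
      obtain ⟨N, hN⟩ := hlim 1 one_pos
      have h : (s N : L2) - v ∈ D :=
        (hD _).2 ((hN N le_rfl).trans_lt ENNReal.ofReal_lt_top)
      have := D.sub_mem (s N).2 h
      rwa [sub_sub_cancel] at this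
    refine ⟨⟨v, hvD⟩, ?_⟩
    have h1 : Tendsto (fun n => B (s n - ⟨v, hvD⟩) (s n - ⟨v, hvD⟩)) atTop (𝓝 0) := by
      refine Metric.tendsto_atTop.2 fun ε hε => ?_
      obtain ⟨N, hN⟩ := hlim (ε / 2) (by positivity)
      refine ⟨N, fun n hn => ?_⟩
      have h := hN n hn
      have e : (s n : L2) - v = ((s n - ⟨v, hvD⟩ : D) : L2) := rfl
      rw [e, hval, ENNReal.ofReal_le_ofReal_iff (by positivity)] at h
      rw [Real.dist_eq, sub_zero, abs_of_nonneg (hpos _)]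
      linarith
    have h2 : Tendsto (fun n => ‖((s n - ⟨v, hvD⟩ : D) : L2)‖ ^ 2) atTop (𝓝 0) := by
      have := (tendsto_iff_norm_sub_tendsto_zero.1 hv).pow 2
      simpa using this
    simpa using h1.add h2

end ClosedForm

/-! ### The two families of forms and Mosco convergence -/

/-- The bilinear form with diagonal `cellSum n`. -/
noncomputable def cellForm (n : ℕ) : C(K, ℝ) →ₗ[ℝ] C(K, ℝ) →ₗ[ℝ] ℝ :=
  LinearMap.mk₂ ℝ
    (fun u v => ∑ w : Fin n → Fin 3, ∑ i : Fin 3, ∑ j : Fin 3,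
      (u (wordMap n w (p i)) - u (wordMap n w (p j))) *
        (v (wordMap n w (p i)) - v (wordMap n w (p j))))
    (fun u u' v => by
      simp only [← Finset.sum_add_distrib, ContinuousMap.add_apply]
      refine Finset.sum_congr rfl fun w _ => Finset.sum_congr rfl fun i _ =>
        Finset.sum_congr rfl fun j _ => ?_
      ring)
    (fun c u v => by
      simp only [smul_eq_mul, Finset.mul_sum, ContinuousMap.smul_apply]
      refine Finset.sum_congr rfl fun w _ => Finset.sum_congr rfl fun i _ =>
        Finset.sum_congr rfl fun j _ => ?_
      ring)
    (fun u v v' => by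
      simp only [← Finset.sum_add_distrib, ContinuousMap.add_apply]
      refine Finset.sum_congr rfl fun w _ => Finset.sum_congr rfl fun i _ =>
        Finset.sum_congr rfl fun j _ => ?_
      ring)
    (fun c u v => by
      simp only [smul_eq_mul, Finset.mul_sum, ContinuousMap.smul_apply]
      refine Finset.sum_congr rfl fun w _ => Finset.sum_congr rfl fun i _ =>
        Finset.sum_congr rfl fun j _ => ?_
      ring)

theorem cellForm_self (n : ℕ) (u : C(K, ℝ)) : cellForm n u u = cellSum n u := by
  simp only [cellForm, LinearMap.mk₂_apply, cellSum, pow_two]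

theorem cellForm_comm (n : ℕ) (u v : C(K, ℝ)) : cellForm n u v = cellForm n v u := by
  simp only [cellForm, LinearMap.mk₂_apply, mul_comm]

theorem isClosedForm_localForm : IsClosedForm localForm := by
  refine isClosedForm_extend (E := localEnergy) (Q := fun n => (5 / 3 : ℝ) ^ n • cellForm n)
    (fun n u v => ?_) (fun n u => ?_) (fun u => ?_)
    (fun v ε hε => exists_localEnergy_lt_top_near v hε) (fun s v c hs hc => localForm_lsc hs hc)
  · simp only [LinearMap.smul_apply, cellForm_comm n u v]
  · simp only [LinearMap.smul_apply, cellForm_self, smul_eq_mul]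
    exact mul_nonneg (by positivity) (cellSum_nonneg _ _)
  · simp only [LinearMap.smul_apply, cellForm_self, smul_eq_mul]
    exact tendsto_levelEnergy u

/-- The approximating forms are the partial sums of the series. The domain is dense because it
contains every continuous function of finite local energy. -/
theorem isClosedForm_scaledForm {β : ℝ} (hβ : α < β) (hβ' : β < βstar) :
    IsClosedForm (scaledForm β) := by
  have h0 : 0 ≤ 1 - (5 : ℝ)⁻¹ * (2 : ℝ) ^ β := by
    rw [← coe_decay, sub_nonneg]
    exact (decay_lt_one hβ').le
  have hlsc := fun s v c => scaledForm_lsc hβ hβ' (s := s) (v := v) (c := c)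
  rw [scaledForm_eq hβ'] at hlsc ⊢
  refine isClosedForm_extend (E := scaledEnergy β) (Q := fun N => ∑ n ∈ Finset.range N,
      ((1 - (5 : ℝ)⁻¹ * (2 : ℝ) ^ β) * (2 : ℝ) ^ ((β - α) * ((n + 1 : ℕ) : ℝ))) •
        cellForm (n + 1))
    (fun N u v => ?_) (fun N u => ?_) (fun u => ?_) (fun v ε hε => ?_) hlsc
  · simp only [LinearMap.sum_apply, LinearMap.smul_apply, cellForm_comm _ u v]
  · simp only [LinearMap.sum_apply, LinearMap.smul_apply, cellForm_self, smul_eq_mul]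
    exact Finset.sum_nonneg fun n _ =>
      mul_nonneg (mul_nonneg h0 (by positivity)) (cellSum_nonneg _ _)
  · simp only [LinearMap.sum_apply, LinearMap.smul_apply, cellForm_self, smul_eq_mul]
    rw [scaledEnergy, discreteEnergy, ← ENNReal.tsum_mul_left]
    refine ENNReal.summable.hasSum.tendsto_sum_nat.congr fun N => ?_
    rw [ENNReal.ofReal_sum_of_nonneg fun n _ =>
      mul_nonneg (mul_nonneg h0 (by positivity)) (cellSum_nonneg _ _)]
    exact Finset.sum_congr rfl fun n _ => by rw [← ENNReal.ofReal_mul h0, mul_assoc]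
  · obtain ⟨u, hu, huv⟩ := exists_localEnergy_lt_top_near v hε
    exact ⟨u, (scaledEnergy_le_localEnergy hβ' u).trans_lt hu, huv⟩

/-! ### Mosco convergence of the monotone family -/

theorem scaledForm_le_liminf {β : ℝ} (hβ : α < β) (hβ' : β < βstar) {u : ℕ → L2} {v : L2}
    (h : WeaklyConverges u v) :
    scaledForm β v ≤ liminf (fun n => scaledForm β (u n)) atTop := by
  refine ENNReal.le_of_forall_pos_le_add fun ε hε hfin => ?_
  have hlt : liminf (fun n => scaledForm β (u n)) atTop <
      liminf (fun n => scaledForm β (u n)) atTop + ε :=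
    ENNReal.lt_add_right hfin.ne (by exact_mod_cast hε.ne')
  -- A subsequence with energies below liminf + ε puts the problem in the form of `scaledForm_lsc`.
  obtain ⟨φ, hφ, hle⟩ := extraction_of_frequently_atTop
    (frequently_lt_of_liminf_lt (by isBoundedDefault) hlt)
  have htop : liminf (fun n => scaledForm β (u n)) atTop + ε ≠ ⊤ :=
    ENNReal.add_ne_top.2 ⟨hfin.ne, ENNReal.coe_ne_top⟩
  rw [← ENNReal.coe_toNNReal htop]
  refine scaledForm_lsc hβ hβ' (h.comp_tendsto hφ.tendsto_atTop) fun n => ?_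
  rw [ENNReal.coe_toNNReal htop]
  exact (hle n).le

/-- For fixed β < β* one has b_n > β eventually, so monotonicity in β and lower semicontinuity of
the form at β give the bound; then β ↑ β*. -/
theorem localForm_le_liminf {b : ℕ → ℝ} (hb : ∀ n, b n ∈ Set.Ioo α βstar)
    (hlim : Tendsto b atTop (𝓝 βstar)) {u : ℕ → L2} {v : L2} (h : WeaklyConverges u v) :
    localForm v ≤ liminf (fun n => scaledForm (b n) (u n)) atTop := by
  refine le_of_tendsto (tendsto_scaledForm v) ?_
  filter_upwards [Ioo_mem_nhdsLT ((hb 0).1.trans (hb 0).2)] with β hβ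
  refine (scaledForm_le_liminf hβ.1 hβ.2 h).trans (liminf_le_liminf ?_)
  filter_upwards [(tendsto_order.1 hlim).1 β hβ.2] with n hn
  exact scaledForm_mono hn.le (hb n).2 _

theorem moscoConverges_scaledForm {b : ℕ → ℝ} (hb : ∀ n, b n ∈ Set.Ioo α βstar)
    (hlim : Tendsto b atTop (𝓝 βstar)) :
    MoscoConverges (fun n => scaledForm (b n)) localForm where
  isClosedForm_seq n := isClosedForm_scaledForm (hb n).1 (hb n).2
  isClosedForm_limit := isClosedForm_localForm
  le_liminf _ _ h := localForm_le_liminf hb hlim h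
  limsup_le v := ⟨fun _ => v, tendsto_const_nhds, limsup_le_of_le (by isBoundedDefault)
    (Eventually.of_forall fun n => scaledForm_le_localForm (hb n).2 v)⟩

end Gasket

/-! ### The main theorem -/

theorem theorem1p6 :
    (∀ β : ℝ, Gasket.α < β → ∃ C : ℝ≥0, 0 < C ∧ ∀ u : C(Gasket.K, ℝ),
      Gasket.discreteEnergy β u ≤ C * Gasket.stableEnergy β u ∧
      Gasket.stableEnergy β u ≤ C * Gasket.discreteEnergy β u) ∧
    (∀ u : Gasket.L2,
      MonotoneOn (fun β => Gasket.scaledForm β u) (Set.Ioo Gasket.α Gasket.βstar) ∧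
      Tendsto (fun β => Gasket.scaledForm β u) (𝓝[<] Gasket.βstar) (𝓝 (Gasket.localForm u))) ∧
    (∀ b : ℕ → ℝ, (∀ n, b n ∈ Set.Ioo Gasket.α Gasket.βstar) → Monotone b →
      Tendsto b atTop (𝓝 Gasket.βstar) →
      Gasket.MoscoConverges (fun n => Gasket.scaledForm (b n)) Gasket.localForm) := by
  refine ⟨fun β hβ => ?_, fun u => ⟨fun β _ γ hγ h => Gasket.scaledForm_mono h hγ.2 u,
    Gasket.tendsto_scaledForm u⟩, fun b hb _ hlim => Gasket.moscoConverges_scaledForm hb hlim⟩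
  obtain ⟨C₁, h₁⟩ := Gasket.discreteEnergy_le_stableEnergy hβ
  obtain ⟨C₂, h₂⟩ := Gasket.stableEnergy_le_discreteEnergy hβ
  -- The sum serves both inequalities at once; the extra 1 makes it positive.
  refine ⟨C₁ + C₂ + 1, by positivity, fun u => ⟨(h₁ u u.continuous).trans ?_,
    (h₂ u u.continuous).trans ?_⟩⟩
  · gcongr
    rw [add_assoc]
    exact le_self_add
  · gcongr
    rw [add_right_comm]
    exact le_add_self
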